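/- Let $d,m\ge 1$, $T>0$, and let $H:\mathbb{R}^d\to\mathbb{R}^d$ and $G^\ell:\mathbb{R}^d\to\mathbb{R}^d$, $\ell=1,\dots,d$, be locally Lipschitz with sub-linear growth, i.e. $|H(\xi)|\le C_H(1+|\xi|)$ and $|G^\ell(\xi)|\le C_G^\ell(1+|\xi|)$ for all $\xi$. Let $\mathcal{P}_1(\mathbb{R}^d)$ be the set of Borel probability measures on $\mathbb{R}^d$ with finite first moment, $\mathcal{W}_1$ the $1$-Wasserstein distance, and $\chi=\mathbb{R}^{dm}\times\mathcal{P}_1(\mathbb{R}^d)$ with the distance $\frac1m\sum_{k=1}^m|Y_k-Y_k'|+\mathcal{W}_1(\mu,\mu')$. For $Y,\mathbf{u}\in(\mathbb{R}^d)^m$ put $\mu_{m\ell}=\frac1m\sum_{k=1}^m u_{k\ell}\,\delta_{Y_k}$, where $u_{k\ell}$ is the $\ell$-th coordinate of $\mathbf{u}_k$, so that $G^\ell*\mu_{m\ell}(x)=\frac1m\sum_{k=1}^m u_{k\ell}\,G^\ell(x-Y_k)$. Let $(Y^0,\mu^0)\in\chi$ with $\mu^0$ supported in a closed ball $\bar B(0,R)$.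 For each $N$ let $\mu^0_N=\frac1N\sum_{i=1}^N\delta_{X^0_{N,i}}$ with $X^0_{N,i}\in \bar B(0,R)$, and assume $\mathcal{W}_1(\mu^0_N,\mu^0)\to0$. Let $\mathcal{U}\subset\mathbb{R}^{md}$ be nonempty and compact, and let $\mathbf{u}_N,\mathbf{u}^*\in L^\infty([0,T],\mathcal{U})$ with $\mathbf{u}_N\to\mathbf{u}^*$ in $L^\infty$. Then: 1. For each $N$, the system $$\dot Y_k=\mathbf{u}_{N,k}\ (k=1,\dots,m),\qquad \dot X_i=H*\mu_N(X_i)+\sum_{\ell=1}^d G^\ell*\mu_{m\ell}(X_i)\ (i=1,\dots,N),\qquad \mu_N=\frac1N\sum_{j=1}^N\delta_{X_j},$$ with $\mu_{m\ell}$ built from $Y$ and the control $\mathbf{u}_N$, and with initial datum $(Y^0,X^0_N)$, has exactly one Carath\'eodory solution on $[0,T]$ (absolutely continuous, satisfying the equations for a.e. $t$). Denote it by $(Y_N,X_N)$ and let $\mu_N(t)$ be the empirical measure of $X_N(t)$. 2. The sequence $(Y_N,\mu_N)$ converges in $C^0([0,T],\chi)$, i.e. uniformly on $[0,T]$ in the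 distance of $\chi$, to some $(Y^*,\mu^*)$ with $(Y^*(0),\mu^*(0))=(Y^0,\mu^0)$ which is a solution with control $\mathbf{u}^*$ of $$\dot Y_k=\mathbf{u}_k,\qquad \partial_t\mu+\nabla\cdot\Bigl[\bigl(H*\mu+\sum_{\ell=1}^dG^\ell*\mu_{m\ell}\bigr)\mu\Bigr]=0$$ in the following sense: there is $R'>0$ with $\mathrm{supp}\,\mu^*(t)\subset B(0,R')$ for all $t\in[0,T]$; $t\mapsto(Y^*(t),\mu^*(t))$ is continuous from $[0,T]$ to $\chi$; $Y^*$ is a Carath\'eodory solution of $\dot Y^*_k=\mathbf{u}^*_k$; and for every $\varphi\in C_c^\infty(\mathbb{R}^d)$ the function $t\mapsto\int\varphi\,d\mu^*(t)$ is absolutely continuous on $[0,T]$ with $$\frac{d}{dt}\int_{\mathbb{R}^d}\varphi\,d\mu^*(t)=\int_{\mathbb{R}^d}\nabla\varphi(x)\cdot\Bigl(H*\mu^*(t)(x)+\sum_{\ell=1}^dG^\ell*\mu_{m\ell}(t)(x)\Bigr)d\mu^*(t)(x)\quad\text{for a.e. }t\in[0,T],$$ where $\mu_{m\ell}(t)$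 is built from $Y^*(t)$ and $\mathbf{u}^*(t)$. -/

import Mathlib

open MeasureTheory Filter Topology
open scoped ENNReal ContDiff

noncomputable section

/-- The state space `ℝ^d` of one agent, with the Euclidean norm. -/
abbrev AgentSpace (d : ℕ) : Type := EuclideanSpace ℝ (Fin d)

/-- Membership in `𝒫₁(ℝ^d)`: probability measures with finite first moment. -/
structure MemP1 {d : ℕ} (μ : Measure (AgentSpace d)) : Prop where
  isProbability : IsProbabilityMeasure μ
  finite_moment : Integrable (fun x => ‖x‖) μ

/-- The `1`-Wasserstein distance: the infimum over all couplings `π` of `μ` and `ν` of the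
transport cost `∫ |x - y| dπ(x, y)`, as an extended nonnegative number. -/
def wassersteinOne {d : ℕ} (μ ν : Measure (AgentSpace d)) : ℝ≥0∞ :=
  ⨅ (π : Measure (AgentSpace d × AgentSpace d))
    (_ : π.map Prod.fst = μ ∧ π.map Prod.snd = ν), ∫⁻ p, edist p.1 p.2 ∂π

/-- The distance on `χ = ℝ^{dm} × 𝒫₁(ℝ^d)`:
`(1/m) ∑ k, |Y k - Y' k| + W₁(μ, μ')`. -/
def chiDist {d m : ℕ} (Y : Fin m → AgentSpace d) (μ : Measure (AgentSpace d))
    (Y' : Fin m → AgentSpace d) (μ' : Measure (AgentSpace d)) : ℝ≥0∞ :=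
  (m : ℝ≥0∞)⁻¹ * ∑ k, edist (Y k) (Y' k) + wassersteinOne μ μ'

/-- The empirical measure `(1/N) ∑ i, δ_{X i}`. -/
def empirical {d N : ℕ} (X : Fin N → AgentSpace d) : Measure (AgentSpace d) :=
  (N : ℝ≥0∞)⁻¹ • ∑ i, Measure.dirac (X i)

/-- The kernels: `H` and all `G ℓ` are locally Lipschitz with sub-linear growth. -/
structure KernelHypothesis {d : ℕ} (H : AgentSpace d → AgentSpace d)
    (G : Fin d → AgentSpace d → AgentSpace d) : Prop where
  lipschitz_H : LocallyLipschitz H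
  lipschitz_G : ∀ ℓ, LocallyLipschitz (G ℓ)
  growth_H : ∃ C : ℝ, ∀ ξ, ‖H ξ‖ ≤ C * (1 + ‖ξ‖)
  growth_G : ∀ ℓ, ∃ C : ℝ, ∀ ξ, ‖G ℓ ξ‖ ≤ C * (1 + ‖ξ‖)

/-- `u ∈ L^∞([0,T], 𝒰)`, for a compact set `𝒰` of control values. -/
structure IsControl {d m : ℕ} (T : ℝ) (𝒰 : Set (Fin m → AgentSpace d))
    (u : ℝ → Fin m → AgentSpace d) : Prop where
  measurable : AEStronglyMeasurable u (volume.restrict (Set.Icc 0 T))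
  mem : ∀ᵐ t ∂(volume.restrict (Set.Icc 0 T)), u t ∈ 𝒰

/-- The convolution `H * μ`. -/
def convH {d : ℕ} (H : AgentSpace d → AgentSpace d) (μ : Measure (AgentSpace d))
    (x : AgentSpace d) : AgentSpace d :=
  ∫ z, H (x - z) ∂μ

/-- The convolution of `g` with the finitely supported signed measure
`(1/m) ∑ k, v k ℓ • δ_{Y k}`, where `v k ℓ` is the `ℓ`-th coordinate of the `k`-th control. -/
def convG {d m : ℕ} (g : AgentSpace d → AgentSpace d) (Y v : Fin m → AgentSpace d) (ℓ : Fin d)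
    (x : AgentSpace d) : AgentSpace d :=
  (m : ℝ)⁻¹ • ∑ k, v k ℓ • g (x - Y k)

/-- The velocity field `H * μ + ∑ ℓ, G ℓ * μ_{mℓ}`. -/
def velocity {d m : ℕ} (H : AgentSpace d → AgentSpace d)
    (G : Fin d → AgentSpace d → AgentSpace d) (μ : Measure (AgentSpace d))
    (Y v : Fin m → AgentSpace d) (x : AgentSpace d) : AgentSpace d :=
  convH H μ x + ∑ ℓ, convG (G ℓ) Y v ℓ x

/-- `Y' = w` on `[0,T]` in the Caratheodory sense: `Y` is absolutely continuous on `[0,T]` and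
has derivative `w t` at almost every `t ∈ [0,T]`. -/
structure HasCaratheodoryDeriv {F : Type*} [NormedAddCommGroup F] [NormedSpace ℝ F] (T : ℝ)
    (y w : ℝ → F) : Prop where
  absolutelyContinuous : AbsolutelyContinuousOnInterval y 0 T
  ae_hasDerivAt : ∀ᵐ t ∂(volume.restrict (Set.Icc 0 T)), HasDerivAt y (w t) t

/-- Caratheodory solutions of the finite system with `m` leaders and `N` followers, control `u`
and initial datum `(Y0, X0)`. -/
structure IsFiniteSolution {d m N : ℕ} (H : AgentSpace d → AgentSpace d)
    (G : Fin d → AgentSpace d → AgentSpace d) (T : ℝ) (u : ℝ → Fin m → AgentSpace d)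
    (Y0 : Fin m → AgentSpace d) (X0 : Fin N → AgentSpace d)
    (Y : ℝ → Fin m → AgentSpace d) (X : ℝ → Fin N → AgentSpace d) : Prop where
  initial_leaders : Y 0 = Y0
  initial_followers : X 0 = X0
  leaders : ∀ k, HasCaratheodoryDeriv T (fun t => Y t k) (fun t => u t k)
  followers : ∀ i, HasCaratheodoryDeriv T (fun t => X t i)
    (fun t => velocity H G (empirical (X t)) (Y t) (u t) (X t i))

/-- Weak measure-valued solutions `(Y, μ) : [0,T] → χ` of
`Y' = u`, `∂ₜ μ + ∇ · ((H * μ + ∑ ℓ, G ℓ * μ_{mℓ}) μ) = 0`, with control `u`. Since `u` is only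
measurable in time, the weak equation is understood, as the leaders' one, in the Caratheodory
sense. -/
structure IsMeanFieldSolution {d m : ℕ} (H : AgentSpace d → AgentSpace d)
    (G : Fin d → AgentSpace d → AgentSpace d) (T : ℝ) (u : ℝ → Fin m → AgentSpace d)
    (Y : ℝ → Fin m → AgentSpace d) (μ : ℝ → Measure (AgentSpace d)) : Prop where
  memP1 : ∀ t ∈ Set.Icc 0 T, MemP1 (μ t)
  support : ∃ R : ℝ, 0 < R ∧ ∀ t ∈ Set.Icc 0 T, (μ t).support ⊆ Metric.ball 0 R
  continuous : ∀ t ∈ Set.Icc 0 T,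
    Tendsto (fun s => chiDist (Y s) (μ s) (Y t) (μ t)) (𝓝[Set.Icc 0 T] t) (𝓝 0)
  leaders : ∀ k, HasCaratheodoryDeriv T (fun t => Y t k) (fun t => u t k)
  weak : ∀ φ : AgentSpace d → ℝ, ContDiff ℝ ∞ φ → HasCompactSupport φ →
    HasCaratheodoryDeriv T (fun t => ∫ x, φ x ∂(μ t))
      (fun t => ∫ x, inner ℝ (gradient φ x) (velocity H G (μ t) (Y t) (u t) x) ∂(μ t))

end

/-!
The finite systems and the mean-field equation are instances of one Lagrangian system. Given a
distribution `P` of labels and initial positions `x₀`, the flow `t ↦ Φ t` of the followers solves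
an ordinary differential equation in the Banach space of bounded continuous functions of the label:
the velocity of the label `q` is `(H * μ + ∑ ℓ, G ℓ * μ_{mℓ}) (Φ t q)` with `μ` the law of `Φ t`
under `P`. For bounded Lipschitz kernels this is a Carathéodory equation with a Lipschitz right
hand side, solved by Picard iteration; for `P` an empirical measure it is the finite system, and in
general the law of `Φ t` solves the continuity equation. Kernels of sub-linear growth reduce to
this case: Grönwall's inequality confines the solutions to a ball independent of the truncation of
the kernels, so truncating outside a larger ball changes nothing.

For convergence, a coupling `π` of two label distributions makes both flows Lagrangian solutions
over the single label measure `π`. Grönwall's inequality then bounds the `π`-mean distance of the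
flows by that of the labels and the distance of the controls, and the infimum over `π` turns this
into an estimate in the Wasserstein distance.
-/

noncomputable section

open Set NNReal BoundedContinuousFunction

section CaratheodoryDeriv

variable {E F : Type*} [NormedAddCommGroup E] [NormedAddCommGroup F]

theorem absolutelyContinuousOnInterval_of_dist_le {K : ℝ} {f : ℝ → E} {g : ℝ → F} {a b : ℝ}
    (hf : AbsolutelyContinuousOnInterval f a b)
    (hg : ∀ s ∈ uIcc a b, ∀ t ∈ uIcc a b, dist (g s) (g t) ≤ K * dist (f s) (f t)) :
    AbsolutelyContinuousOnInterval g a b := by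
  have hlim := Tendsto.const_mul K hf
  rw [mul_zero] at hlim
  refine squeeze_zero' (.of_forall fun _ => Finset.sum_nonneg fun _ _ => dist_nonneg) ?_ hlim
  filter_upwards [mem_inf_of_right (mem_principal_self _)] with I hI
  rw [Finset.mul_sum]
  exact Finset.sum_le_sum fun i hi => hg _ (hI.1 i hi).1 _ (hI.1 i hi).2

theorem absolutelyContinuousOnInterval_comp_lipschitz {K : ℝ≥0} {f : ℝ → E} {g : E → F}
    {a b : ℝ} (hg : LipschitzWith K g) (hf : AbsolutelyContinuousOnInterval f a b) :
    AbsolutelyContinuousOnInterval (fun t => g (f t)) a b :=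
  absolutelyContinuousOnInterval_of_dist_le hf fun _ _ _ _ => hg.dist_le_mul _ _

theorem absolutelyContinuousOnInterval_pi {ι : Type*} [Fintype ι] {f : ℝ → ι → E} {a b : ℝ}
    (hf : ∀ i, AbsolutelyContinuousOnInterval (fun t => f t i) a b) :
    AbsolutelyContinuousOnInterval f a b := by
  have hlim := tendsto_finsetSum Finset.univ fun i _ => hf i
  rw [Finset.sum_const_zero] at hlim
  refine squeeze_zero (fun _ => Finset.sum_nonneg fun _ _ => dist_nonneg) (fun I => ?_) hlim
  rw [Finset.sum_comm]
  refine Finset.sum_le_sum fun n _ => (dist_pi_le_iff (by positivity)).2 fun i => ?_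
  exact Finset.single_le_sum (f := fun i => dist (f (I.2 n).1 i) (f (I.2 n).2 i))
    (fun _ _ => dist_nonneg) (Finset.mem_univ i)

theorem le_add_mul_of_ae_deriv_le {f : ℝ → ℝ} {a b C : ℝ} (hab : a ≤ b)
    (hf : AbsolutelyContinuousOnInterval f a b)
    (hC : ∀ᵐ t ∂(volume.restrict (Icc a b)), deriv f t ≤ C) : f b ≤ f a + C * (b - a) := by
  have hmono := intervalIntegral.integral_mono_ae_restrict hab hf.intervalIntegrable_deriv
    intervalIntegrable_const hC
  rw [hf.integral_deriv_eq_sub, intervalIntegral.integral_const, smul_eq_mul] at hmono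
  linarith

variable [NormedSpace ℝ E] [NormedSpace ℝ F]

theorem deriv_norm_le {y : ℝ → E} {v : E} {t : ℝ} (hy : HasDerivAt y v t)
    (hn : DifferentiableAt ℝ (fun s => ‖y s‖) t) : deriv (fun s => ‖y s‖) t ≤ ‖v‖ := by
  refine le_of_tendsto_of_tendsto (hasDerivAt_iff_tendsto_slope.1 hn.hasDerivAt)
    (hasDerivAt_iff_tendsto_slope.1 hy).norm (Eventually.of_forall fun s => ?_)
  refine (le_abs_self _).trans ?_
  simp only [slope_def_module, smul_eq_mul, abs_mul, abs_inv, norm_smul, norm_inv,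
    Real.norm_eq_abs]
  gcongr
  exact abs_norm_sub_norm_le _ _

namespace HasCaratheodoryDeriv

variable {T : ℝ} {y y' w w' : ℝ → E}

theorem congr_ae (hy : HasCaratheodoryDeriv T y w) (hw : w =ᵐ[volume.restrict (Icc 0 T)] w') :
    HasCaratheodoryDeriv T y w' where
  absolutelyContinuous := hy.absolutelyContinuous
  ae_hasDerivAt := by
    filter_upwards [hy.ae_hasDerivAt, hw] with t ht he using he ▸ ht

theorem sub (hy : HasCaratheodoryDeriv T y w) (hy' : HasCaratheodoryDeriv T y' w') :
    HasCaratheodoryDeriv T (fun t => y t - y' t) (fun t => w t - w' t) where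
  absolutelyContinuous := hy.absolutelyContinuous.sub hy'.absolutelyContinuous
  ae_hasDerivAt := by
    filter_upwards [hy.ae_hasDerivAt, hy'.ae_hasDerivAt] with t ht ht' using ht.sub ht'

theorem clm_comp (A : E →L[ℝ] F) (hy : HasCaratheodoryDeriv T y w) :
    HasCaratheodoryDeriv T (fun t => A (y t)) (fun t => A (w t)) where
  absolutelyContinuous :=
    absolutelyContinuousOnInterval_comp_lipschitz A.lipschitz hy.absolutelyContinuous
  ae_hasDerivAt := by
    filter_upwards [hy.ae_hasDerivAt] with t ht using A.hasFDerivAt.comp_hasDerivAt t ht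

theorem pi {ι : Type*} [Fintype ι] {z v : ℝ → ι → E}
    (hz : ∀ i, HasCaratheodoryDeriv T (fun t => z t i) (fun t => v t i)) :
    HasCaratheodoryDeriv T z v where
  absolutelyContinuous := absolutelyContinuousOnInterval_pi fun i => (hz i).absolutelyContinuous
  ae_hasDerivAt := by
    filter_upwards [ae_all_iff.2 fun i => (hz i).ae_hasDerivAt] with t ht using hasDerivAt_pi.2 ht

theorem continuousOn (hy : HasCaratheodoryDeriv T y w) : ContinuousOn y (Icc 0 T) :=
  hy.absolutelyContinuous.continuousOn.mono Icc_subset_uIcc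

/-- Grönwall's inequality: `‖y‖ * exp (-K * t)` is absolutely continuous with derivative at most
`ε`. -/
theorem norm_le {K ε : ℝ} (hK : 0 ≤ K) (hε : 0 ≤ ε) (hy : HasCaratheodoryDeriv T y w)
    (hw : ∀ᵐ t ∂(volume.restrict (Icc 0 T)), ‖w t‖ ≤ K * ‖y t‖ + ε) {t : ℝ} (ht : t ∈ Icc 0 T) :
    ‖y t‖ ≤ (‖y 0‖ + ε * T) * Real.exp (K * T) := by
  have hsub : Icc 0 t ⊆ Icc 0 T := Icc_subset_Icc_right ht.2
  have hnorm : AbsolutelyContinuousOnInterval (fun s => ‖y s‖) 0 t :=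
    (absolutelyContinuousOnInterval_comp_lipschitz lipschitzWith_one_norm
      hy.absolutelyContinuous).mono (by rwa [uIcc_of_le ht.1, uIcc_of_le (ht.1.trans ht.2)])
  have hexp : AbsolutelyContinuousOnInterval (fun s => Real.exp (-K * s)) 0 t :=
    ContDiffOn.absolutelyContinuousOnInterval (by fun_prop)
  have hdiff : ∀ᵐ s ∂(volume.restrict (Icc 0 t)), DifferentiableAt ℝ (fun s => ‖y s‖) s := by
    rw [ae_restrict_iff' measurableSet_Icc, ← uIcc_of_le ht.1]
    exact hnorm.ae_differentiableAt
  have hbound := le_add_mul_of_ae_deriv_le (C := ε) ht.1 (hnorm.mul hexp) (by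
    filter_upwards [hdiff, ae_restrict_of_ae_restrict_of_subset hsub hy.ae_hasDerivAt,
      ae_restrict_of_ae_restrict_of_subset hsub hw, ae_restrict_mem measurableSet_Icc]
      with s hs hys hws hs0
    have hder := hs.hasDerivAt.mul ((hasDerivAt_id s).const_mul (-K)).exp
    have hexp_le : Real.exp (-K * s) ≤ 1 := Real.exp_le_one_iff.2 (by nlinarith [hs0.1])
    have hstep := (deriv_norm_le hys hs).trans hws
    refine hder.deriv.trans_le ?_
    simp only [id_eq, mul_one]
    nlinarith [Real.exp_pos (-K * s)])
  simp only [Pi.mul_apply, mul_zero, Real.exp_zero, mul_one, sub_zero] at hbound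
  calc ‖y t‖ = ‖y t‖ * Real.exp (-K * t) * Real.exp (K * t) := by
        rw [mul_assoc, ← Real.exp_add]; simp
    _ ≤ (‖y 0‖ + ε * t) * Real.exp (K * t) := by gcongr
    _ ≤ (‖y 0‖ + ε * T) * Real.exp (K * T) := by
        have h0 := ht.1
        have hT := ht.2
        have := h0.trans hT
        gcongr

theorem eqOn {K : ℝ} (hK : 0 ≤ K) (hy : HasCaratheodoryDeriv T y w)
    (hy' : HasCaratheodoryDeriv T y' w')
    (hw : ∀ᵐ t ∂(volume.restrict (Icc 0 T)), ‖w t - w' t‖ ≤ K * ‖y t - y' t‖) (h0 : y 0 = y' 0) :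
    EqOn y y' (Icc 0 T) := by
  intro t ht
  have hle := (hy.sub hy').norm_le hK le_rfl (by simpa using hw) ht
  rwa [h0, sub_self, norm_zero, zero_mul, add_zero, zero_mul, norm_le_zero_iff, sub_eq_zero]
    at hle

end HasCaratheodoryDeriv

end CaratheodoryDeriv

section Picard

variable {E : Type*} [NormedAddCommGroup E] [NormedSpace ℝ E] {T : ℝ}

theorem HasCaratheodoryDeriv.of_eq_integral [CompleteSpace E] {x g : ℝ → E} {x₀ : E} (hT : 0 ≤ T)
    (hg : IntegrableOn g (Icc 0 T)) (hx : ∀ t ∈ Icc 0 T, x t = x₀ + ∫ s in (0 : ℝ)..t, g s) :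
    HasCaratheodoryDeriv T x g := by
  have hint : IntervalIntegrable g volume 0 T := by
    rwa [intervalIntegrable_iff_integrableOn_Icc_of_le hT]
  have h0 : (0 : ℝ) ∈ uIcc 0 T := left_mem_uIcc
  have hsub {s t : ℝ} (hs : s ∈ uIcc 0 T) (ht : t ∈ uIcc 0 T) : uIcc s t ⊆ uIcc 0 T :=
    ordConnected_uIcc.uIcc_subset hs ht
  rw [← uIcc_of_le hT] at hx
  constructor
  · refine absolutelyContinuousOnInterval_of_dist_le (K := 1)
      (hint.norm.absolutelyContinuousOnInterval_intervalIntegral h0) fun s hs t ht => ?_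
    rw [hx s hs, hx t ht, dist_add_left, one_mul, dist_eq_norm, dist_eq_norm,
      intervalIntegral.integral_interval_sub_left (hint.mono_set (hsub h0 hs))
        (hint.mono_set (hsub h0 ht)),
      intervalIntegral.integral_interval_sub_left (hint.norm.mono_set (hsub h0 hs))
        (hint.norm.mono_set (hsub h0 ht))]
    exact intervalIntegral.norm_integral_le_abs_integral_norm
  · rw [Measure.restrict_congr_set Ioo_ae_eq_Icc.symm, ae_restrict_iff' measurableSet_Ioo]
    filter_upwards [hint.ae_hasDerivAt_integral] with t ht htI
    refine ((ht (by rw [uIcc_of_le hT]; exact Ioo_subset_Icc_self htI) 0 h0).const_add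
      x₀).congr_of_eventuallyEq ?_
    filter_upwards [Icc_mem_nhds htI.1 htI.2] with s hs
    exact hx s (by rwa [uIcc_of_le hT])

/-- The Picard operator of `x' = F t x`, `x 0 = x₀` on the continuous curves over `[0, T]`; curves
are extended by constants outside `[0, T]` where the integral asks for a function on `ℝ`. -/
def picardMap (hT : 0 ≤ T) {F : ℝ → E → E}
    (hF : ∀ α : C(Icc 0 T, E), IntegrableOn (fun s => F s (IccExtend hT α s)) (Icc 0 T)) (x₀ : E)
    (α : C(Icc 0 T, E)) : C(Icc 0 T, E) where
  toFun t := x₀ + ∫ s in (0 : ℝ)..t, F s (IccExtend hT α s)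
  continuous_toFun := by
    have hcont := intervalIntegral.continuousOn_primitive_interval (a := 0) (b := T)
      (by rw [uIcc_of_le hT]; exact hF α)
    rw [uIcc_of_le hT] at hcont
    exact continuous_const.add (continuousOn_iff_continuous_domRestrict.1 hcont)

variable {L : ℝ≥0} {F : ℝ → E → E}

theorem dist_iterate_picardMap_le (hT : 0 ≤ T)
    (hF : ∀ α : C(Icc 0 T, E), IntegrableOn (fun s => F s (IccExtend hT α s)) (Icc 0 T)) (x₀ : E)
    (hL : ∀ᵐ s ∂(volume.restrict (Icc 0 T)), LipschitzWith L (F s)) (α β : C(Icc 0 T, E)) (n : ℕ)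
    (t : Icc 0 T) :
    dist ((picardMap hT hF x₀)^[n] α t) ((picardMap hT hF x₀)^[n] β t) ≤
      (L * t) ^ n / n.factorial * dist α β := by
  induction n generalizing t with
  | zero => simpa using ContinuousMap.dist_apply_le_dist t
  | succ n ih =>
    have hint (γ : C(Icc 0 T, E)) :
        IntervalIntegrable (fun s => F s (IccExtend hT γ s)) volume 0 t := by
      rw [intervalIntegrable_iff_integrableOn_Icc_of_le t.2.1]
      exact (hF γ).mono_set (Icc_subset_Icc_right t.2.2)
    rw [Function.iterate_succ_apply', Function.iterate_succ_apply', dist_eq_norm]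
    simp only [picardMap, ContinuousMap.coe_mk, add_sub_add_left_eq_sub]
    rw [← intervalIntegral.integral_sub (hint _) (hint _)]
    have hstep : ∀ᵐ s : ℝ, s ∈ Ioc 0 (t : ℝ) →
        ‖F s (IccExtend hT ((picardMap hT hF x₀)^[n] α) s) -
          F s (IccExtend hT ((picardMap hT hF x₀)^[n] β) s)‖ ≤
        L * ((L * s) ^ n / n.factorial * dist α β) := by
      filter_upwards [(ae_restrict_iff' measurableSet_Icc).1 hL] with s hLs hs
      have hsT : s ∈ Icc 0 T := ⟨hs.1.le, hs.2.trans t.2.2⟩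
      rw [← dist_eq_norm, IccExtend_of_mem _ _ hsT, IccExtend_of_mem _ _ hsT]
      exact ((hLs hsT).dist_le_mul _ _).trans (by gcongr; exact ih ⟨s, hsT⟩)
    refine (intervalIntegral.norm_integral_le_of_norm_le t.2.1 hstep
      (Continuous.intervalIntegrable (by fun_prop) _ _)).trans_eq ?_
    simp only [mul_pow, intervalIntegral.integral_const_mul, intervalIntegral.integral_mul_const,
      intervalIntegral.integral_div, integral_pow, Nat.factorial_succ, Nat.cast_mul]
    push_cast
    field_simp
    ring

theorem exists_hasCaratheodoryDeriv [CompleteSpace E] {M : ℝ} (hT : 0 ≤ T)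
    (hL : ∀ᵐ s ∂(volume.restrict (Icc 0 T)), LipschitzWith L (F s))
    (hM : ∀ᵐ s ∂(volume.restrict (Icc 0 T)), ‖F s 0‖ ≤ M)
    (hmeas : ∀ x : ℝ → E, Continuous x →
      AEStronglyMeasurable (fun s => F s (x s)) (volume.restrict (Icc 0 T))) (x₀ : E) :
    ∃ x : ℝ → E, Continuous x ∧ x 0 = x₀ ∧ HasCaratheodoryDeriv T x (fun s => F s (x s)) := by
  have hF (α : C(Icc 0 T, E)) : IntegrableOn (fun s => F s (IccExtend hT α s)) (Icc 0 T) := by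
    refine Integrable.of_bound (hmeas _ α.continuous.Icc_extend') (M + L * ‖α‖) ?_
    filter_upwards [hL, hM] with s hLs hMs
    have hdist := hLs.norm_sub_le (IccExtend hT α s) 0
    rw [sub_zero] at hdist
    have hα : ‖IccExtend hT α s‖ ≤ ‖α‖ := α.norm_coe_le_norm _
    have hLα : L * ‖IccExtend hT α s‖ ≤ L * ‖α‖ := by gcongr
    linarith [norm_sub_norm_le (F s (IccExtend hT α s)) (F s 0)]
  obtain ⟨n, hn⟩ := ((FloorSemiring.tendsto_pow_div_factorial_atTop (L * T)).eventually
    (gt_mem_nhds zero_lt_one)).exists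
  have hcontr : ContractingWith ⟨(L * T) ^ n / n.factorial, by positivity⟩
      (picardMap hT hF x₀)^[n] := by
    refine ⟨hn, LipschitzWith.of_dist_le_mul fun α β => ?_⟩
    refine (ContinuousMap.dist_le (mul_nonneg (NNReal.coe_nonneg _) dist_nonneg)).2 fun t => ?_
    refine (dist_iterate_picardMap_le hT hF x₀ hL α β n t).trans ?_
    have h0 := t.2.1
    have hT := t.2.2
    change _ ≤ (L * T) ^ n / n.factorial * dist α β
    gcongr
  obtain ⟨α, hα⟩ : ∃ α, picardMap hT hF x₀ α = α := ⟨_, hcontr.isFixedPt_fixedPoint_iterate⟩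
  have hfix (t : ℝ) (ht : t ∈ Icc 0 T) :
      IccExtend hT α t = x₀ + ∫ s in (0 : ℝ)..t, F s (IccExtend hT α s) := by
    rw [IccExtend_of_mem hT α ht]
    exact (DFunLike.congr_fun hα ⟨t, ht⟩).symm
  refine ⟨IccExtend hT α, α.continuous.Icc_extend', ?_, .of_eq_integral hT (hF α) hfix⟩
  simpa using hfix 0 ⟨le_rfl, hT⟩

end Picard

section BallRetraction

variable {E : Type*} [NormedAddCommGroup E] [NormedSpace ℝ E] {r : ℝ}

/-- The radial retraction of a normed space onto the closed ball of radius `r` (for `0 < r`), used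
to truncate kernels and initial labels without changing them on that ball. -/
def ballRetraction (r : ℝ) (x : E) : E :=
  (r / max r ‖x‖) • x

theorem ballRetraction_of_norm_le (hr : 0 < r) {x : E} (hx : ‖x‖ ≤ r) : ballRetraction r x = x := by
  rw [ballRetraction, max_eq_left hx, div_self hr.ne', one_smul]

theorem norm_ballRetraction_le_norm (hr : 0 < r) (x : E) : ‖ballRetraction r x‖ ≤ ‖x‖ := by
  rw [ballRetraction, norm_smul, Real.norm_of_nonneg (by positivity)]
  exact mul_le_of_le_one_left (norm_nonneg x) (div_le_one_of_le₀ (le_max_left _ _) (by positivity))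

theorem norm_ballRetraction_le (hr : 0 < r) (x : E) : ‖ballRetraction r x‖ ≤ r := by
  rw [ballRetraction, norm_smul, Real.norm_of_nonneg (by positivity), div_mul_eq_mul_div,
    div_le_iff₀ (by positivity)]
  gcongr
  exact le_max_right _ _

theorem lipschitzWith_ballRetraction (hr : 0 < r) :
    LipschitzWith 2 (ballRetraction r : E → E) := by
  refine LipschitzWith.of_dist_le_mul fun x y => ?_
  set a := max r ‖x‖
  set b := max r ‖y‖
  have ha : 0 < a := hr.trans_le (le_max_left _ _)
  have hb : 0 < b := hr.trans_le (le_max_left _ _)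
  have hab : |b - a| ≤ ‖x - y‖ := by
    rw [abs_sub_comm]
    exact (abs_max_sub_max_le_max _ _ _ _).trans (by simpa using abs_norm_sub_norm_le x y)
  have hsplit : ballRetraction r x - ballRetraction r y =
      (r / a) • (x - y) + ((r / a) * ((b - a) / b)) • y := by
    rw [show r / a * ((b - a) / b) = r / a - r / b by field, smul_sub, sub_smul]
    simp only [ballRetraction, a, b]
    abel
  have hra : r / a ≤ 1 := div_le_one_of_le₀ (le_max_left _ _) ha.le
  have hyb : |b - a| / b * ‖y‖ ≤ ‖x - y‖ := by
    rw [div_mul_eq_mul_div, div_le_iff₀ hb]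
    exact mul_le_mul hab (le_max_right _ _) (norm_nonneg y) (norm_nonneg _)
  calc dist (ballRetraction r x) (ballRetraction r y)
      ≤ r / a * ‖x - y‖ + r / a * (|b - a| / b * ‖y‖) := by
        rw [dist_eq_norm, hsplit]
        refine (norm_add_le _ _).trans_eq ?_
        rw [norm_smul, norm_smul, norm_mul, norm_div (b - a), Real.norm_eq_abs (b - a),
          Real.norm_of_nonneg hb.le, Real.norm_of_nonneg (by positivity : 0 ≤ r / a)]
        ring
    _ ≤ 1 * ‖x - y‖ + 1 * ‖x - y‖ := by gcongr
    _ = (2 : ℝ≥0) * dist x y := by rw [dist_eq_norm, NNReal.coe_ofNat]; ring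

theorem exists_lipschitzWith_bcf_eqOn_closedBall (hr : 0 < r) :
    ∃ f : E →ᵇ E, LipschitzWith 2 f ∧ ‖f‖ ≤ r ∧ EqOn f id (Metric.closedBall 0 r) :=
  ⟨.ofNormedAddCommGroup (ballRetraction r) (lipschitzWith_ballRetraction hr).continuous r
      (norm_ballRetraction_le hr),
    lipschitzWith_ballRetraction hr, norm_ofNormedAddCommGroup_le _ hr.le _,
    fun _ hx => ballRetraction_of_norm_le hr (mem_closedBall_zero_iff.1 hx)⟩

end BallRetraction

section Kernels

variable {d : ℕ} {H : AgentSpace d → AgentSpace d} {G : Fin d → AgentSpace d → AgentSpace d}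

/-- The kernels `H` and `G ℓ` are all `L`-Lipschitz and bounded by `B`. -/
structure BoundedLipschitzKernels (L B : ℝ≥0) (H : AgentSpace d → AgentSpace d)
    (G : Fin d → AgentSpace d → AgentSpace d) : Prop where
  lipschitz_H : LipschitzWith L H
  lipschitz_G : ∀ ℓ, LipschitzWith L (G ℓ)
  norm_H_le : ∀ ξ, ‖H ξ‖ ≤ B
  norm_G_le : ∀ ℓ ξ, ‖G ℓ ξ‖ ≤ B

/-- Sub-linear growth of all the kernels `H` and `G ℓ` with a common constant. -/
structure LinearGrowthKernels (C : ℝ≥0) (H : AgentSpace d → AgentSpace d)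
    (G : Fin d → AgentSpace d → AgentSpace d) : Prop where
  norm_H_le : ∀ ξ, ‖H ξ‖ ≤ C * (1 + ‖ξ‖)
  norm_G_le : ∀ ℓ ξ, ‖G ℓ ξ‖ ≤ C * (1 + ‖ξ‖)

/-- Two families of kernels agree on the closed ball of radius `r`. -/
structure KernelsEqOn (r : ℝ) (H H' : AgentSpace d → AgentSpace d)
    (G G' : Fin d → AgentSpace d → AgentSpace d) : Prop where
  eq_H : EqOn H H' (Metric.closedBall 0 r)
  eq_G : ∀ ℓ, EqOn (G ℓ) (G' ℓ) (Metric.closedBall 0 r)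

theorem KernelHypothesis.exists_linearGrowthKernels (hHG : KernelHypothesis H G) :
    ∃ C : ℝ≥0, LinearGrowthKernels C H G := by
  obtain ⟨C₀, h₀⟩ := hHG.growth_H
  choose C₁ h₁ using hHG.growth_G
  refine ⟨C₀.toNNReal + ∑ ℓ, (C₁ ℓ).toNNReal, fun ξ => (h₀ ξ).trans ?_,
    fun ℓ ξ => (h₁ ℓ ξ).trans ?_⟩ <;> gcongr
  · exact (Real.le_coe_toNNReal _).trans (NNReal.coe_le_coe.2 le_self_add)
  · refine (Real.le_coe_toNNReal _).trans (NNReal.coe_le_coe.2 (le_trans ?_ le_add_self))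
    exact Finset.single_le_sum (f := fun ℓ => (C₁ ℓ).toNNReal) (fun _ _ => zero_le)
      (Finset.mem_univ ℓ)

theorem LinearGrowthKernels.comp_ballRetraction {C : ℝ≥0} (hC : LinearGrowthKernels C H G) {r : ℝ}
    (hr : 0 < r) :
    LinearGrowthKernels C (H ∘ ballRetraction r) (fun ℓ => G ℓ ∘ ballRetraction r) where
  norm_H_le ξ := (hC.norm_H_le _).trans (by gcongr; exact norm_ballRetraction_le_norm hr ξ)
  norm_G_le ℓ ξ := (hC.norm_G_le ℓ _).trans (by gcongr; exact norm_ballRetraction_le_norm hr ξ)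

theorem KernelsEqOn.symm {r : ℝ} {H' : AgentSpace d → AgentSpace d}
    {G' : Fin d → AgentSpace d → AgentSpace d} (h : KernelsEqOn r H H' G G') :
    KernelsEqOn r H' H G' G where
  eq_H := h.eq_H.symm
  eq_G ℓ := (h.eq_G ℓ).symm

theorem kernelsEqOn_comp_ballRetraction {r : ℝ} (hr : 0 < r) :
    KernelsEqOn r H (H ∘ ballRetraction r) G (fun ℓ => G ℓ ∘ ballRetraction r) where
  eq_H ξ hξ := by
    rw [Function.comp_apply, ballRetraction_of_norm_le hr (mem_closedBall_zero_iff.1 hξ)]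
  eq_G ℓ ξ hξ := by
    rw [Function.comp_apply, ballRetraction_of_norm_le hr (mem_closedBall_zero_iff.1 hξ)]

theorem exists_lipschitzWith_comp_ballRetraction {E F : Type*} [NormedAddCommGroup E]
    [NormedSpace ℝ E] [ProperSpace E] [PseudoMetricSpace F] {f : E → F} (hf : LocallyLipschitz f)
    {r : ℝ} (hr : 0 < r) : ∃ L : ℝ≥0, LipschitzWith L (f ∘ ballRetraction r) := by
  obtain ⟨L, hL⟩ := LocallyLipschitzOn.exists_lipschitzOnWith_of_compact
    (isCompact_closedBall (0 : E) r) hf.locallyLipschitzOn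
  refine ⟨L * 2, lipschitzOnWith_univ.1 (hL.comp (lipschitzWith_ballRetraction hr).lipschitzOnWith
    fun ξ _ => ?_)⟩
  exact mem_closedBall_zero_iff.2 (norm_ballRetraction_le hr ξ)

theorem KernelHypothesis.exists_boundedLipschitzKernels (hHG : KernelHypothesis H G) {r : ℝ}
    (hr : 0 < r) :
    ∃ L B, BoundedLipschitzKernels L B (H ∘ ballRetraction r)
      (fun ℓ => G ℓ ∘ ballRetraction r) := by
  obtain ⟨C, hC⟩ := hHG.exists_linearGrowthKernels
  obtain ⟨L₀, h₀⟩ := exists_lipschitzWith_comp_ballRetraction hHG.lipschitz_H hr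
  choose L₁ h₁ using fun ℓ => exists_lipschitzWith_comp_ballRetraction (hHG.lipschitz_G ℓ) hr
  refine ⟨L₀ + ∑ ℓ, L₁ ℓ, C * (1 + r.toNNReal), h₀.weaken le_self_add, fun ℓ => (h₁ ℓ).weaken ?_,
    fun ξ => (hC.norm_H_le _).trans ?_, fun ℓ ξ => (hC.norm_G_le ℓ _).trans ?_⟩
  · exact (Finset.single_le_sum (fun _ _ => zero_le) (Finset.mem_univ ℓ)).trans le_add_self
  all_goals
    push_cast [Real.coe_toNNReal r hr.le]
    gcongr
    exact norm_ballRetraction_le hr ξ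

end Kernels

section Velocity

variable {d m : ℕ} {H : AgentSpace d → AgentSpace d} {G : Fin d → AgentSpace d → AgentSpace d}
  {L B : ℝ≥0} {Y Y' v v' : Fin m → AgentSpace d} {x x' : AgentSpace d}

theorem norm_inv_smul_sum_le {E : Type*} [NormedAddCommGroup E] [NormedSpace ℝ E] {w : Fin m → E}
    {c : ℝ} (hc : 0 ≤ c) (hw : ∀ k, ‖w k‖ ≤ c) : ‖(m : ℝ)⁻¹ • ∑ k, w k‖ ≤ c := by
  have hsum : ‖∑ k, w k‖ ≤ m * c := (norm_sum_le_of_le _ fun k _ => hw k).trans_eq (by simp)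
  rw [norm_smul, norm_inv, Real.norm_natCast]
  exact inv_mul_le_of_le_mul₀ (by positivity) hc hsum

theorem norm_coord_le (v : Fin m → AgentSpace d) (k : Fin m) (ℓ : Fin d) : ‖v k ℓ‖ ≤ ‖v‖ :=
  (PiLp.norm_apply_le (v k) ℓ).trans (norm_le_pi_norm v k)

theorem norm_convG_le {g : AgentSpace d → AgentSpace d} {c : ℝ} (hc : 0 ≤ c)
    (hg : ∀ k, ‖g (x - Y k)‖ ≤ c) (ℓ : Fin d) : ‖convG g Y v ℓ x‖ ≤ ‖v‖ * c := by
  refine norm_inv_smul_sum_le (by positivity) fun k => ?_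
  rw [norm_smul]
  gcongr
  exacts [norm_coord_le v k ℓ, hg k]

theorem norm_convG_sub_le {g : AgentSpace d → AgentSpace d} (hgL : LipschitzWith L g)
    (hgB : ∀ ξ, ‖g ξ‖ ≤ B) (ℓ : Fin d) :
    ‖convG g Y v ℓ x - convG g Y' v' ℓ x'‖ ≤
      B * ‖v - v'‖ + ‖v'‖ * (L * (‖x - x'‖ + ‖Y - Y'‖)) := by
  rw [convG, convG, ← smul_sub, ← Finset.sum_sub_distrib]
  refine norm_inv_smul_sum_le (by positivity) fun k => ?_
  have hsplit : v k ℓ • g (x - Y k) - v' k ℓ • g (x' - Y' k) =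
      (v - v') k ℓ • g (x - Y k) + v' k ℓ • (g (x - Y k) - g (x' - Y' k)) := by
    simp only [Pi.sub_apply, PiLp.sub_apply, sub_smul, smul_sub]
    abel
  have hg : ‖g (x - Y k) - g (x' - Y' k)‖ ≤ L * (‖x - x'‖ + ‖Y - Y'‖) := by
    refine (hgL.norm_sub_le _ _).trans ?_
    gcongr
    rw [sub_sub_sub_comm]
    exact (norm_sub_le _ _).trans (by gcongr; exact norm_le_pi_norm (Y - Y') k)
  rw [hsplit]
  refine (norm_add_le _ _).trans ?_
  rw [norm_smul, norm_smul, mul_comm (B : ℝ)]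
  gcongr
  exacts [norm_coord_le _ k ℓ, hgB _, norm_coord_le _ k ℓ]

theorem norm_velocity_le {μ : Measure (AgentSpace d)} [IsZeroOrProbabilityMeasure μ] {c : ℝ}
    (hc : 0 ≤ c) (hH : ∀ᵐ z ∂μ, ‖H (x - z)‖ ≤ c) (hG : ∀ ℓ k, ‖G ℓ (x - Y k)‖ ≤ c) :
    ‖velocity H G μ Y v x‖ ≤ (1 + d * ‖v‖) * c := by
  have hconvH : ‖convH H μ x‖ ≤ c :=
    (norm_integral_le_of_norm_le_const hH).trans (mul_le_of_le_one_right hc measureReal_le_one)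
  have hconvG : ‖∑ ℓ, convG (G ℓ) Y v ℓ x‖ ≤ d * (‖v‖ * c) :=
    (norm_sum_le_of_le _ fun ℓ _ => norm_convG_le hc (hG ℓ) ℓ).trans_eq (by simp)
  exact (norm_add_le _ _).trans (by linarith)

theorem LinearGrowthKernels.norm_velocity_le {C : ℝ≥0} (hC : LinearGrowthKernels C H G)
    {μ : Measure (AgentSpace d)} [IsZeroOrProbabilityMeasure μ] {ρ : ℝ} (hμ : ∀ᵐ z ∂μ, ‖z‖ ≤ ρ)
    (hY : ‖Y‖ ≤ ρ) (hx : ‖x‖ ≤ ρ) :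
    ‖velocity H G μ Y v x‖ ≤ (1 + d * ‖v‖) * (C * (1 + 2 * ρ)) := by
  have hρ := (norm_nonneg x).trans hx
  have hdiff {z : AgentSpace d} (hz : ‖z‖ ≤ ρ) : ‖x - z‖ ≤ 2 * ρ :=
    (norm_sub_le x z).trans (by linarith)
  refine _root_.norm_velocity_le (by positivity) ?_ fun ℓ k => ?_
  · filter_upwards [hμ] with z hz
    exact (hC.norm_H_le _).trans (by gcongr; exact hdiff hz)
  · exact (hC.norm_G_le ℓ _).trans (by gcongr; exact hdiff ((norm_le_pi_norm Y k).trans hY))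

theorem KernelsEqOn.velocity_eq {H' : AgentSpace d → AgentSpace d}
    {G' : Fin d → AgentSpace d → AgentSpace d} {ρ : ℝ} (hHG : KernelsEqOn (2 * ρ) H H' G G')
    {μ : Measure (AgentSpace d)} (hμ : ∀ᵐ z ∂μ, ‖z‖ ≤ ρ) (hY : ‖Y‖ ≤ ρ) (hx : ‖x‖ ≤ ρ) :
    velocity H G μ Y v x = velocity H' G' μ Y v x := by
  have hdiff {z : AgentSpace d} (hz : ‖z‖ ≤ ρ) : x - z ∈ Metric.closedBall 0 (2 * ρ) :=
    mem_closedBall_zero_iff.2 ((norm_sub_le x z).trans (by linarith))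
  have hconvH : convH H μ x = convH H' μ x := by
    refine integral_congr_ae ?_
    filter_upwards [hμ] with z hz using hHG.eq_H (hdiff hz)
  have hconvG (ℓ : Fin d) : convG (G ℓ) Y v ℓ x = convG (G' ℓ) Y v ℓ x := by
    simp only [convG, hHG.eq_G ℓ (hdiff ((norm_le_pi_norm Y _).trans hY))]
  simp only [velocity, hconvH, hconvG]

variable {Ω : Type*} [MeasurableSpace Ω] {P : Measure Ω} {a b : Ω → AgentSpace d}

theorem convH_map (hH : Continuous H) (ha : AEMeasurable a P) (x : AgentSpace d) :
    convH H (P.map a) x = ∫ q, H (x - a q) ∂P :=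
  integral_map ha (hH.comp (continuous_const.sub continuous_id)).aestronglyMeasurable

variable [IsZeroOrProbabilityMeasure P]

theorem norm_convH_map_sub_le (hHL : LipschitzWith L H) (hHB : ∀ ξ, ‖H ξ‖ ≤ B)
    (ha : AEMeasurable a P) (hb : AEMeasurable b P) (hab : Integrable (fun q => a q - b q) P) :
    ‖convH H (P.map a) x - convH H (P.map b) x'‖ ≤ L * (‖x - x'‖ + ∫ q, ‖a q - b q‖ ∂P) := by
  have hint {c : Ω → AgentSpace d} (hc : AEMeasurable c P) (z : AgentSpace d) :
      Integrable (fun q => H (z - c q)) P :=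
    .of_bound (hHL.continuous.measurable.comp_aemeasurable
      (hc.const_sub z)).aestronglyMeasurable B (.of_forall fun _ => hHB _)
  rw [convH_map hHL.continuous ha, convH_map hHL.continuous hb,
    ← integral_sub (hint ha x) (hint hb x')]
  calc ‖∫ q, H (x - a q) - H (x' - b q) ∂P‖
      ≤ ∫ q, L * (‖x - x'‖ + ‖a q - b q‖) ∂P := by
        refine norm_integral_le_of_norm_le (((integrable_const _).add hab.norm).const_mul _)
          (.of_forall fun q => (hHL.norm_sub_le _ _).trans ?_)
        rw [sub_sub_sub_comm]
        gcongr
        exact norm_sub_le _ _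
    _ = L * (P.real univ * ‖x - x'‖ + ∫ q, ‖a q - b q‖ ∂P) := by
        rw [integral_const_mul, integral_add (integrable_const _) hab.norm, integral_const,
          smul_eq_mul]
    _ ≤ L * (‖x - x'‖ + ∫ q, ‖a q - b q‖ ∂P) := by
        gcongr
        exact mul_le_of_le_one_left (norm_nonneg _) measureReal_le_one

namespace BoundedLipschitzKernels

theorem norm_velocity_sub_le (hK : BoundedLipschitzKernels L B H G) (ha : AEMeasurable a P)
    (hb : AEMeasurable b P) (hab : Integrable (fun q => a q - b q) P) :
    ‖velocity H G (P.map a) Y v x - velocity H G (P.map b) Y' v' x'‖ ≤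
      L * (‖x - x'‖ + ∫ q, ‖a q - b q‖ ∂P) +
        d * (B * ‖v - v'‖ + ‖v'‖ * (L * (‖x - x'‖ + ‖Y - Y'‖))) := by
  rw [velocity, velocity, add_sub_add_comm, ← Finset.sum_sub_distrib]
  refine norm_add_le_of_le
    (norm_convH_map_sub_le hK.lipschitz_H hK.norm_H_le ha hb hab) ?_
  refine (norm_sum_le_of_le _ fun ℓ _ =>
    norm_convG_sub_le (hK.lipschitz_G ℓ) (hK.norm_G_le ℓ) ℓ).trans_eq ?_
  rw [Finset.sum_const, Finset.card_univ, Fintype.card_fin, nsmul_eq_mul]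

theorem norm_velocity_le (hK : BoundedLipschitzKernels L B H G) {μ : Measure (AgentSpace d)}
    [IsZeroOrProbabilityMeasure μ] : ‖velocity H G μ Y v x‖ ≤ (1 + d * ‖v‖) * B :=
  _root_.norm_velocity_le B.2 (.of_forall fun _ => hK.norm_H_le _) fun ℓ _ => hK.norm_G_le ℓ _

theorem lipschitzWith_velocity (hK : BoundedLipschitzKernels L B H G) (ha : AEMeasurable a P)
    (Y v : Fin m → AgentSpace d) :
    LipschitzWith ((1 + d * ‖v‖₊) * L) (velocity H G (P.map a) Y v) := by
  refine LipschitzWith.of_dist_le_mul fun x x' => ?_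
  have hle := hK.norm_velocity_sub_le (x := x) (x' := x') (Y := Y) (Y' := Y) (v := v) (v' := v)
    ha ha (by simp)
  simp only [sub_self, norm_zero, integral_zero, mul_zero, zero_add, add_zero] at hle
  rw [dist_eq_norm, dist_eq_norm]
  push_cast
  linarith

end BoundedLipschitzKernels

end Velocity

section Lagrangian

variable {d m : ℕ} {H : AgentSpace d → AgentSpace d} {G : Fin d → AgentSpace d → AgentSpace d}
  {L B U : ℝ≥0} (hK : BoundedLipschitzKernels L B H G) {Ω : Type*} [TopologicalSpace Ω]
  [MeasurableSpace Ω] [OpensMeasurableSpace Ω] (P : Measure Ω)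

theorem ae_map_norm_le (f : Ω →ᵇ AgentSpace d) : ∀ᵐ z ∂(P.map f), ‖z‖ ≤ ‖f‖ := by
  rw [ae_map_iff f.continuous.measurable.aemeasurable
    (measurableSet_le measurable_norm measurable_const)]
  exact .of_forall f.norm_coe_le_norm

variable [IsZeroOrProbabilityMeasure P]

/-- The velocity field along a map `f` of labels, `q ↦ (H * f_# P + ∑ ℓ, G ℓ * μ_{mℓ}) (f q)`, as
an element of the Banach space of bounded continuous functions of the label `q`. It is the right
hand side of the equation of the flow. -/
def flowField (Y v : Fin m → AgentSpace d) (f : Ω →ᵇ AgentSpace d) : Ω →ᵇ AgentSpace d :=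
  BoundedContinuousFunction.comp (velocity H G (P.map f) Y v)
    (hK.lipschitzWith_velocity f.continuous.measurable.aemeasurable Y v) f

theorem norm_flowField_sub_le (Y Y' v v' : Fin m → AgentSpace d) (f f' : Ω →ᵇ AgentSpace d) :
    ‖flowField hK P Y v f - flowField hK P Y' v' f'‖ ≤ L * (‖f - f'‖ + ‖f - f'‖) +
      d * (B * ‖v - v'‖ + ‖v'‖ * (L * (‖f - f'‖ + ‖Y - Y'‖))) := by
  refine (norm_le (by positivity)).2 fun q => ?_
  have hpoint (q : Ω) : ‖f q - f' q‖ ≤ ‖f - f'‖ := (f - f').norm_coe_le_norm q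
  have hmean : ∫ q, ‖f q - f' q‖ ∂P ≤ ‖f - f'‖ :=
    (le_abs_self _).trans <| (norm_integral_le_of_norm_le_const
      (.of_forall fun q => (norm_norm _).trans_le (hpoint q))).trans
      (mul_le_of_le_one_right (norm_nonneg _) measureReal_le_one)
  refine (hK.norm_velocity_sub_le f.continuous.measurable.aemeasurable
    f'.continuous.measurable.aemeasurable ((f - f').integrable P)).trans ?_
  gcongr <;> exact hpoint q

theorem lipschitzWith_flowField {v : Fin m → AgentSpace d} (hv : ‖v‖ ≤ U)
    (Y : Fin m → AgentSpace d) :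
    LipschitzWith ((2 + d * U) * L) (flowField hK P Y v) := by
  refine LipschitzWith.of_dist_le_mul fun f f' => ?_
  rw [dist_eq_norm, dist_eq_norm]
  refine (norm_flowField_sub_le hK P Y Y v v f f').trans ?_
  have hvf : d * (‖v‖ * (L * ‖f - f'‖)) ≤ d * (U * (L * ‖f - f'‖)) := by gcongr
  simp only [sub_self, norm_zero, mul_zero, zero_add, add_zero]
  push_cast
  linarith

theorem continuous_flowField :
    Continuous fun p : ((Fin m → AgentSpace d) × (Fin m → AgentSpace d)) × (Ω →ᵇ AgentSpace d) =>
      flowField hK P p.1.1 p.1.2 p.2 := by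
  refine continuous_iff_continuousAt.2 fun p => tendsto_iff_norm_sub_tendsto_zero.2 ?_
  refine squeeze_zero (fun _ => norm_nonneg _) (fun q => norm_flowField_sub_le hK P _ _ _ _ _ _) ?_
  refine (Continuous.tendsto' (by fun_prop) p _ ?_)
  simp

theorem norm_flowField_le (Y v : Fin m → AgentSpace d) (f : Ω →ᵇ AgentSpace d) :
    ‖flowField hK P Y v f‖ ≤ (1 + d * ‖v‖) * B := by
  refine (norm_le (by positivity)).2 fun q => ?_
  exact hK.norm_velocity_le

/-- Lagrangian solutions of the coupled system: the leaders `Y` follow the control `u`, and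
`Φ t q` is the position at time `t` of the follower with label `q`, the labels being distributed
according to `P` and starting at `x₀ q`. -/
structure IsLagrangianSolution (T : ℝ) (u : ℝ → Fin m → AgentSpace d) (Y₀ : Fin m → AgentSpace d)
    (x₀ : Ω →ᵇ AgentSpace d) (Y : ℝ → Fin m → AgentSpace d) (Φ : ℝ → Ω →ᵇ AgentSpace d) :
    Prop where
  initial_leaders : Y 0 = Y₀
  initial_flow : Φ 0 = x₀
  leaders : HasCaratheodoryDeriv T Y u
  flow : HasCaratheodoryDeriv T Φ fun t => flowField hK P (Y t) (u t) (Φ t)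

variable {T : ℝ} {u : ℝ → Fin m → AgentSpace d}

theorem IsControl.mono {𝒰 𝒱 : Set (Fin m → AgentSpace d)} (h𝒰𝒱 : 𝒰 ⊆ 𝒱)
    (hu : IsControl T 𝒰 u) : IsControl T 𝒱 u where
  measurable := hu.measurable
  mem := hu.mem.mono fun _ ht => h𝒰𝒱 ht

theorem IsControl.ae_norm_le (hu : IsControl T (Metric.closedBall 0 U) u) :
    ∀ᵐ t ∂(volume.restrict (Icc 0 T)), ‖u t‖ ≤ U := by
  filter_upwards [hu.mem] with t ht using mem_closedBall_zero_iff.1 ht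

theorem exists_isLagrangianSolution (hT : 0 ≤ T) (hu : IsControl T (Metric.closedBall 0 U) u)
    (Y₀ : Fin m → AgentSpace d) (x₀ : Ω →ᵇ AgentSpace d) :
    ∃ Y Φ, IsLagrangianSolution hK P T u Y₀ x₀ Y Φ := by
  obtain ⟨Y, hYc, hY0, hY⟩ := exists_hasCaratheodoryDeriv (F := fun t _ => u t) (L := 0) hT
    (.of_forall fun t => LipschitzWith.const _) hu.ae_norm_le (fun _ _ => hu.measurable) Y₀
  have hbound : ∀ᵐ t ∂(volume.restrict (Icc 0 T)),
      ‖flowField hK P (Y t) (u t) 0‖ ≤ (1 + d * U) * B := by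
    filter_upwards [hu.ae_norm_le] with t ht
    exact (norm_flowField_le hK P _ _ _).trans (by gcongr)
  obtain ⟨Φ, -, hΦ0, hΦ⟩ := exists_hasCaratheodoryDeriv (F := fun t => flowField hK P (Y t) (u t))
    hT (hu.ae_norm_le.mono fun t ht => lipschitzWith_flowField hK P ht (Y t)) hbound
    (fun f hf => (continuous_flowField hK P).comp_aestronglyMeasurable
      ((hYc.aestronglyMeasurable.prodMk hu.measurable).prodMk hf.aestronglyMeasurable)) x₀
  exact ⟨Y, Φ, hY0, hΦ0, hY, hΦ⟩

/-- A bound for the leaders and the flow of a Lagrangian solution with data of norm at most `r`,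
growth constant `C` and controls of norm at most `U`. It depends on the kernels only through `C`,
so it is the same for all truncations of the kernels. -/
def aprioriBound (d : ℕ) (C U : ℝ≥0) (T r : ℝ) : ℝ :=
  r + U * T + (r + (1 + d * U) * (C * (1 + 2 * (r + U * T))) * T) *
    Real.exp (2 * (1 + d * U) * C * T)

theorem aprioriBound_pos {C : ℝ≥0} {T r : ℝ} (hr : 0 < r) (hT : 0 ≤ T) :
    0 < aprioriBound d C U T r := by
  rw [aprioriBound]
  positivity

namespace IsLagrangianSolution

variable {hK P} {Y₀ : Fin m → AgentSpace d} {x₀ : Ω →ᵇ AgentSpace d}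
  {Y : ℝ → Fin m → AgentSpace d} {Φ : ℝ → Ω →ᵇ AgentSpace d} {r t : ℝ}

theorem norm_leaders_le (h : IsLagrangianSolution hK P T u Y₀ x₀ Y Φ)
    (hu : IsControl T (Metric.closedBall 0 U) u) (ht : t ∈ Icc 0 T) : ‖Y t‖ ≤ ‖Y₀‖ + U * T := by
  have hle := h.leaders.norm_le (K := 0) le_rfl U.coe_nonneg
    (by simpa only [zero_mul, zero_add] using hu.ae_norm_le) ht
  simpa [h.initial_leaders] using hle

theorem norm_flow_le {C : ℝ≥0} (h : IsLagrangianSolution hK P T u Y₀ x₀ Y Φ)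
    (hC : LinearGrowthKernels C H G) (hu : IsControl T (Metric.closedBall 0 U) u)
    (ht : t ∈ Icc 0 T) :
    ‖Φ t‖ ≤ (‖x₀‖ + (1 + d * U) * (C * (1 + 2 * (‖Y₀‖ + U * T))) * T) *
      Real.exp (2 * (1 + d * U) * C * T) := by
  have hT := ht.1.trans ht.2
  rw [← h.initial_flow]
  refine h.flow.norm_le (by positivity) (by positivity) ?_ ht
  filter_upwards [hu.ae_norm_le, ae_restrict_mem measurableSet_Icc] with s hus hs
  have hY : ‖Y s‖ ≤ ‖Y₀‖ + U * T := h.norm_leaders_le hu hs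
  have hpoint (q : Ω) : ‖flowField hK P (Y s) (u s) (Φ s) q‖ ≤
      (1 + d * ‖u s‖) * (C * (1 + 2 * (‖Φ s‖ + (‖Y₀‖ + U * T)))) := by
    refine hC.norm_velocity_le ((ae_map_norm_le P (Φ s)).mono fun z hz => ?_) ?_ ?_
    · exact hz.trans (le_add_of_nonneg_right (by positivity))
    · exact hY.trans (le_add_of_nonneg_left (norm_nonneg _))
    · exact ((Φ s).norm_coe_le_norm q).trans (le_add_of_nonneg_right (by positivity))
  calc ‖flowField hK P (Y s) (u s) (Φ s)‖
      ≤ (1 + d * ‖u s‖) * (C * (1 + 2 * (‖Φ s‖ + (‖Y₀‖ + U * T)))) :=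
        (norm_le (by positivity)).2 hpoint
    _ ≤ (1 + d * U) * (C * (1 + 2 * (‖Φ s‖ + (‖Y₀‖ + U * T)))) := by gcongr
    _ = _ := by ring

theorem norm_le_aprioriBound {C : ℝ≥0} (h : IsLagrangianSolution hK P T u Y₀ x₀ Y Φ)
    (hC : LinearGrowthKernels C H G) (hu : IsControl T (Metric.closedBall 0 U) u)
    (hY₀ : ‖Y₀‖ ≤ r) (hx₀ : ‖x₀‖ ≤ r) (ht : t ∈ Icc 0 T) :
    ‖Y t‖ ≤ aprioriBound d C U T r ∧ ‖Φ t‖ ≤ aprioriBound d C U T r := by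
  have hT := ht.1.trans ht.2
  have hr := (norm_nonneg _).trans hY₀
  have hY : ‖Y t‖ ≤ r + U * T := (h.norm_leaders_le hu ht).trans (by gcongr)
  have hΦ := (h.norm_flow_le hC hu ht).trans (show _ ≤ (r + (1 + d * U) * (C * (1 + 2 *
    (r + U * T))) * T) * Real.exp (2 * (1 + d * U) * C * T) by gcongr)
  exact ⟨hY.trans (le_add_of_nonneg_right (by positivity)),
    hΦ.trans (le_add_of_nonneg_left (by positivity))⟩

end IsLagrangianSolution

end Lagrangian

section Empirical

variable {d N : ℕ}

theorem empirical_eq_map_uniformOn (X : Fin N → AgentSpace d) :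
    empirical X = (ProbabilityTheory.uniformOn univ).map X := by
  have hX : Measurable X := measurable_of_finite X
  ext s hs
  rw [Measure.map_apply hX hs, ProbabilityTheory.uniformOn_univ, Fintype.card_fin,
    ENNReal.div_eq_inv_mul, Measure.count, Measure.sum_fintype]
  simp only [empirical, Measure.smul_apply, Measure.finsetSum_apply, Measure.dirac_apply' _ hs,
    Measure.dirac_apply' _ (hX hs), smul_eq_mul]
  rfl

instance isZeroOrProbabilityMeasure_empirical (X : Fin N → AgentSpace d) :
    IsZeroOrProbabilityMeasure (empirical X) := by
  rw [empirical_eq_map_uniformOn]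
  infer_instance

theorem map_empirical {f : AgentSpace d → AgentSpace d} (hf : Measurable f)
    (X : Fin N → AgentSpace d) : (empirical X).map f = empirical fun i => f (X i) := by
  rw [empirical_eq_map_uniformOn, empirical_eq_map_uniformOn,
    Measure.map_map hf (measurable_of_finite X), Function.comp_def]

theorem ae_empirical_norm_le {X : Fin N → AgentSpace d} {r : ℝ} (hX : ∀ i, ‖X i‖ ≤ r) :
    ∀ᵐ z ∂(empirical X), ‖z‖ ≤ r := by
  rw [empirical_eq_map_uniformOn, ae_map_iff (measurable_of_finite X).aemeasurable
    (measurableSet_le measurable_norm measurable_const)]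
  exact .of_forall hX

end Empirical

theorem map_eq_self_of_eqOn_support {E : Type*} [TopologicalSpace E] [HereditarilyLindelofSpace E]
    [MeasurableSpace E] {μ : Measure E} {f : E → E} (hf : EqOn f id μ.support) :
    μ.map f = μ := by
  have hae : f =ᵐ[μ] id := by
    filter_upwards [Measure.support_mem_ae (μ := μ)] with x hx using hf hx
  rw [Measure.map_congr hae, Measure.map_id]

section Wasserstein

variable {d m : ℕ}

theorem chiDist_le (Y Y' : Fin m → AgentSpace d) (μ μ' : Measure (AgentSpace d)) :
    chiDist Y μ Y' μ' ≤ edist Y Y' + wassersteinOne μ μ' := by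
  rw [chiDist]
  gcongr
  calc (m : ℝ≥0∞)⁻¹ * ∑ k, edist (Y k) (Y' k)
      ≤ (m : ℝ≥0∞)⁻¹ * (m * edist Y Y') := by
        gcongr
        exact (Finset.sum_le_card_nsmul _ _ _ fun k _ => edist_le_pi_edist Y Y' k).trans_eq
          (by simp)
    _ = (m : ℝ≥0∞)⁻¹ * m * edist Y Y' := (mul_assoc _ _ _).symm
    _ ≤ edist Y Y' := mul_le_of_le_one_left zero_le (ENNReal.inv_mul_le_one _)

theorem wassersteinOne_map_le {Ω : Type*} [MeasurableSpace Ω] {P : Measure Ω}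
    {f g : Ω → AgentSpace d} (hf : Measurable f) (hg : Measurable g) :
    wassersteinOne (P.map f) (P.map g) ≤ ∫⁻ q, edist (f q) (g q) ∂P := by
  rw [← lintegral_map (f := fun p : AgentSpace d × AgentSpace d => edist p.1 p.2) (by fun_prop)
    (hf.prodMk hg)]
  refine iInf₂_le _ ⟨?_, ?_⟩
  · rw [Measure.map_map measurable_fst (hf.prodMk hg), Function.comp_def]
  · rw [Measure.map_map measurable_snd (hf.prodMk hg), Function.comp_def]

theorem le_add_mul_wassersteinOne {a b c : ℝ≥0∞} {μ ν : Measure (AgentSpace d)} (hc : c ≠ 0)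
    (hc' : c ≠ ⊤)
    (h : ∀ π : Measure (AgentSpace d × AgentSpace d), π.map Prod.fst = μ → π.map Prod.snd = ν →
      a ≤ b + c * ∫⁻ p, edist p.1 p.2 ∂π) : a ≤ b + c * wassersteinOne μ ν := by
  rw [wassersteinOne, ENNReal.mul_iInf_of_ne hc hc', ENNReal.add_iInf]
  refine le_iInf fun π => ?_
  rw [ENNReal.mul_iInf_of_ne hc hc', ENNReal.add_iInf]
  exact le_iInf fun hπ => h π hπ.1 hπ.2

end Wasserstein

section LagrangianToEulerian

variable {d m N : ℕ} {H H' : AgentSpace d → AgentSpace d}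
  {G G' : Fin d → AgentSpace d → AgentSpace d} {T ρ : ℝ} {u : ℝ → Fin m → AgentSpace d}
  {Y₀ : Fin m → AgentSpace d} {Y : ℝ → Fin m → AgentSpace d}

theorem IsFiniteSolution.congr_kernels {X₀ : Fin N → AgentSpace d} {X : ℝ → Fin N → AgentSpace d}
    (h : IsFiniteSolution H G T u Y₀ X₀ Y X) (hHG : KernelsEqOn (2 * ρ) H H' G G')
    (hY : ∀ t ∈ Icc 0 T, ‖Y t‖ ≤ ρ) (hX : ∀ t ∈ Icc 0 T, ∀ i, ‖X t i‖ ≤ ρ) :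
    IsFiniteSolution H' G' T u Y₀ X₀ Y X where
  initial_leaders := h.initial_leaders
  initial_followers := h.initial_followers
  leaders := h.leaders
  followers i := by
    refine (h.followers i).congr_ae ?_
    filter_upwards [ae_restrict_mem measurableSet_Icc] with t ht
    exact hHG.velocity_eq (ae_empirical_norm_le (hX t ht)) (hY t ht) (hX t ht i)

theorem IsMeanFieldSolution.congr_kernels {μ : ℝ → Measure (AgentSpace d)}
    (h : IsMeanFieldSolution H G T u Y μ) (hHG : KernelsEqOn (2 * ρ) H H' G G')
    (hY : ∀ t ∈ Icc 0 T, ‖Y t‖ ≤ ρ) (hμ : ∀ t ∈ Icc 0 T, ∀ᵐ x ∂(μ t), ‖x‖ ≤ ρ) :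
    IsMeanFieldSolution H' G' T u Y μ where
  memP1 := h.memP1
  support := h.support
  continuous := h.continuous
  leaders := h.leaders
  weak φ hφ hφc := by
    refine (h.weak φ hφ hφc).congr_ae ?_
    filter_upwards [ae_restrict_mem measurableSet_Icc] with t ht
    refine integral_congr_ae ?_
    filter_upwards [hμ t ht] with x hx
    rw [hHG.velocity_eq (hμ t ht) (hY t ht) hx]

variable {Ω : Type*} [TopologicalSpace Ω] [MeasurableSpace Ω] [OpensMeasurableSpace Ω]
  {P : Measure Ω} {φ : AgentSpace d → ℝ} {K : ℝ≥0}

theorem integrable_comp_bcf [IsFiniteMeasure P] (hφ : LipschitzWith K φ) (f : Ω →ᵇ AgentSpace d) :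
    Integrable (fun q => φ (f q)) P :=
  (BoundedContinuousFunction.comp φ hφ f).integrable P

theorem lipschitzWith_integral_comp_bcf [IsZeroOrProbabilityMeasure P] (hφ : LipschitzWith K φ) :
    LipschitzWith K fun f : Ω →ᵇ AgentSpace d => ∫ q, φ (f q) ∂P := by
  refine LipschitzWith.of_dist_le_mul fun f g => ?_
  rw [dist_eq_norm, ← integral_sub (integrable_comp_bcf hφ f) (integrable_comp_bcf hφ g)]
  refine (norm_integral_le_of_norm_le_const (C := K * dist f g) (.of_forall fun q => ?_)).trans
    (mul_le_of_le_one_right (by positivity) measureReal_le_one)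
  rw [← dist_eq_norm]
  exact (hφ.dist_le_mul _ _).trans (by gcongr; exact dist_coe_le_dist q)

theorem hasDerivAt_integral_comp_bcf [IsFiniteMeasure P] (hφ : ContDiff ℝ 1 φ)
    (hφK : LipschitzWith K φ) {Φ : ℝ → Ω →ᵇ AgentSpace d} {w : Ω →ᵇ AgentSpace d} {t : ℝ}
    (hΦ : HasDerivAt Φ w t) :
    HasDerivAt (fun s => ∫ q, φ (Φ s q) ∂P) (∫ q, inner ℝ (gradient φ (Φ t q)) (w q) ∂P) t := by
  obtain ⟨c, hc⟩ := hΦ.isBigO_sub.bound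
  have hgrad : Continuous (gradient φ) :=
    (InnerProductSpace.toDual ℝ (AgentSpace d)).symm.continuous.comp
      (hφ.continuous_fderiv one_ne_zero)
  have hderiv (q : Ω) : HasDerivAt (fun s => φ (Φ s q)) (inner ℝ (gradient φ (Φ t q)) (w q)) t := by
    have hφq := (hφ.differentiable one_ne_zero (Φ t q)).hasGradientAt.hasFDerivAt
    have hΦq : HasDerivAt (fun s => Φ s q) (w q) t :=
      (evalCLM ℝ q : (Ω →ᵇ AgentSpace d) →L[ℝ] AgentSpace d).hasFDerivAt.comp_hasDerivAt t hΦ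
    simpa only [InnerProductSpace.toDual_apply_apply] using! hφq.comp_hasDerivAt t hΦq
  have hlip (q : Ω) (s : ℝ) (hs : ‖Φ s - Φ t‖ ≤ c * ‖s - t‖) :
      ‖φ (Φ s q) - φ (Φ t q)‖ ≤ K * c * ‖s - t‖ := by
    rw [mul_assoc]
    refine (hφK.norm_sub_le _ _).trans ?_
    gcongr
    exact ((Φ s - Φ t).norm_coe_le_norm q).trans hs
  have hint : Continuous fun q => inner ℝ (gradient φ (Φ t q)) (w q) :=
    (hgrad.comp (Φ t).continuous).inner w.continuous
  obtain ⟨hF', hmain⟩ := hasFDerivAt_integral_of_dominated_loc_of_lip' (μ := P)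
    (F := fun s q => φ (Φ s q)) (bound := fun _ => K * c) hc
    (fun s _ => (integrable_comp_bcf hφK (Φ s)).aestronglyMeasurable)
    (integrable_comp_bcf hφK (Φ t))
    ((ContinuousLinearMap.toSpanSingletonCLE (𝕜 := ℝ)).continuous.comp hint).aestronglyMeasurable
    (.of_forall hlip) (integrable_const _) (.of_forall fun q => (hderiv q).hasFDerivAt)
  refine hmain.hasDerivAt.congr_deriv ?_
  rw [ContinuousLinearMap.integral_apply hF']
  exact integral_congr_ae (.of_forall fun q => one_smul ℝ _)

namespace IsLagrangianSolution

variable {L B : ℝ≥0} {hK : BoundedLipschitzKernels L B H G}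

theorem isFiniteSolution {X₀ : Fin N → AgentSpace d} {x₀ : AgentSpace d →ᵇ AgentSpace d}
    {Φ : ℝ → AgentSpace d →ᵇ AgentSpace d}
    (h : IsLagrangianSolution hK (empirical X₀) T u Y₀ x₀ Y Φ) (hx₀ : ∀ i, x₀ (X₀ i) = X₀ i) :
    IsFiniteSolution H G T u Y₀ X₀ Y fun t i => Φ t (X₀ i) where
  initial_leaders := h.initial_leaders
  initial_followers := funext fun i => by rw [h.initial_flow, hx₀]
  leaders k := h.leaders.clm_comp (ContinuousLinearMap.proj k)
  followers i := by
    simpa only [← map_empirical (Φ _).continuous.measurable] using!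
      h.flow.clm_comp (evalCLM ℝ (X₀ i))

variable [IsProbabilityMeasure P] {x₀ : Ω →ᵇ AgentSpace d} {Φ : ℝ → Ω →ᵇ AgentSpace d}

theorem tendsto_chiDist (h : IsLagrangianSolution hK P T u Y₀ x₀ Y Φ) {t : ℝ}
    (ht : t ∈ Icc 0 T) :
    Tendsto (fun s => chiDist (Y s) (P.map (Φ s)) (Y t) (P.map (Φ t))) (𝓝[Icc 0 T] t) (𝓝 0) := by
  have hlim := (tendsto_iff_edist_tendsto_0.1 (h.leaders.continuousOn t ht)).add
    (tendsto_iff_edist_tendsto_0.1 (h.flow.continuousOn t ht))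
  rw [add_zero] at hlim
  refine tendsto_of_tendsto_of_tendsto_of_le_of_le tendsto_const_nhds hlim (fun _ => zero_le)
    fun s => (chiDist_le _ _ _ _).trans ?_
  gcongr
  refine (wassersteinOne_map_le (Φ s).continuous.measurable (Φ t).continuous.measurable).trans ?_
  calc ∫⁻ q, edist (Φ s q) (Φ t q) ∂P ≤ ∫⁻ _, edist (Φ s) (Φ t) ∂P := by
        gcongr with q
        simpa using (lipschitz_eval_const q).edist_le_mul (Φ s) (Φ t)
    _ = edist (Φ s) (Φ t) := by simp

theorem hasCaratheodoryDeriv_integral (h : IsLagrangianSolution hK P T u Y₀ x₀ Y Φ)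
    (hφ : ContDiff ℝ 1 φ) (hφK : LipschitzWith K φ) :
    HasCaratheodoryDeriv T (fun t => ∫ x, φ x ∂(P.map (Φ t))) fun t =>
      ∫ x, inner ℝ (gradient φ x) (velocity H G (P.map (Φ t)) (Y t) (u t) x) ∂(P.map (Φ t)) := by
  have hΦ (t : ℝ) : AEMeasurable (Φ t) P := (Φ t).continuous.measurable.aemeasurable
  have hgrad : Continuous (gradient φ) :=
    (InnerProductSpace.toDual ℝ (AgentSpace d)).symm.continuous.comp
      (hφ.continuous_fderiv one_ne_zero)
  have hinner (t : ℝ) :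
      Continuous fun x => inner ℝ (gradient φ x) (velocity H G (P.map (Φ t)) (Y t) (u t) x) :=
    hgrad.inner (hK.lipschitzWith_velocity (hΦ t) (Y t) (u t)).continuous
  have hmass (t : ℝ) : ∫ x, φ x ∂(P.map (Φ t)) = ∫ q, φ (Φ t q) ∂P :=
    integral_map (hΦ t) hφ.continuous.aestronglyMeasurable
  have hflux (t : ℝ) : ∫ x, inner ℝ (gradient φ x) (velocity H G (P.map (Φ t)) (Y t) (u t) x)
      ∂(P.map (Φ t)) = ∫ q, inner ℝ (gradient φ (Φ t q)) (flowField hK P (Y t) (u t) (Φ t) q) ∂P :=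
    integral_map (hΦ t) (hinner t).aestronglyMeasurable
  simp only [hmass, hflux]
  have hlip : LipschitzWith K fun f : Ω →ᵇ AgentSpace d => ∫ q, φ (f q) ∂P :=
    lipschitzWith_integral_comp_bcf hφK
  have hcont := absolutelyContinuousOnInterval_comp_lipschitz hlip h.flow.absolutelyContinuous
  refine ⟨hcont, ?_⟩
  filter_upwards [h.flow.ae_hasDerivAt] with t ht using hasDerivAt_integral_comp_bcf hφ hφK ht

theorem isMeanFieldSolution (h : IsLagrangianSolution hK P T u Y₀ x₀ Y Φ) :
    IsMeanFieldSolution H G T u Y fun t => P.map (Φ t) where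
  memP1 t _ :=
    { isProbability := Measure.isProbabilityMeasure_map (Φ t).continuous.measurable.aemeasurable
      finite_moment := .of_bound continuous_norm.aestronglyMeasurable ‖Φ t‖
        ((ae_map_norm_le P (Φ t)).mono fun z hz => (norm_norm z).trans_le hz) }
  support := by
    obtain ⟨ρ, hρ⟩ := isCompact_Icc.exists_bound_of_continuousOn h.flow.continuousOn
    refine ⟨|ρ| + 1, by positivity, fun t ht => ?_⟩
    refine (Measure.support_subset_of_isClosed Metric.isClosed_closedBall ?_).trans
      (Metric.closedBall_subset_ball (lt_add_one |ρ|))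
    filter_upwards [ae_map_norm_le P (Φ t)] with z hz
    exact mem_closedBall_zero_iff.2 (hz.trans ((hρ t ht).trans (le_abs_self ρ)))
  continuous _ ht := h.tendsto_chiDist ht
  leaders k := h.leaders.clm_comp (ContinuousLinearMap.proj k)
  weak φ hφ hφc := by
    obtain ⟨K, hφK⟩ := hφ.lipschitzWith_of_hasCompactSupport hφc (by simp)
    exact h.hasCaratheodoryDeriv_integral (hφ.of_le (by simp)) hφK

end IsLagrangianSolution

end LagrangianToEulerian

section Stability

variable {d m : ℕ} {H : AgentSpace d → AgentSpace d} {G : Fin d → AgentSpace d → AgentSpace d}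
  {L B U : ℝ≥0} {hK : BoundedLipschitzKernels L B H G} {Ω : Type*} [TopologicalSpace Ω]
  [MeasurableSpace Ω]

theorem norm_toLp_one_bcf [BorelSpace Ω] (P : Measure Ω) [IsFiniteMeasure P]
    (f : Ω →ᵇ AgentSpace d) :
    ‖BoundedContinuousFunction.toLp 1 P ℝ f‖ = ∫ q, ‖f q‖ ∂P := by
  rw [L1.norm_eq_integral_norm]
  exact integral_congr_ae ((coeFn_toLp P (p := 1) (𝕜 := ℝ) f).fun_comp norm)

theorem integral_norm_flowField_sub_le [OpensMeasurableSpace Ω] (P : Measure Ω)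
    [IsZeroOrProbabilityMeasure P] (Y Y' v v' : Fin m → AgentSpace d) (f f' : Ω →ᵇ AgentSpace d) :
    ∫ q, ‖(flowField hK P Y v f - flowField hK P Y' v' f') q‖ ∂P ≤
      L * (∫ q, ‖(f - f') q‖ ∂P + ∫ q, ‖(f - f') q‖ ∂P) +
        d * (B * ‖v - v'‖ + ‖v'‖ * (L * (∫ q, ‖(f - f') q‖ ∂P + ‖Y - Y'‖))) := by
  set D := ∫ q, ‖(f - f') q‖ ∂P with hD
  have hint : Integrable (fun q => ‖(f - f') q‖) P := ((f - f').integrable P).norm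
  have hpoint (q : Ω) : ‖(flowField hK P Y v f - flowField hK P Y' v' f') q‖ ≤
      (L + d * ‖v'‖ * L) * ‖(f - f') q‖ +
        (L * D + d * (B * ‖v - v'‖ + ‖v'‖ * (L * ‖Y - Y'‖))) := by
    refine (hK.norm_velocity_sub_le f.continuous.measurable.aemeasurable
      f'.continuous.measurable.aemeasurable ((f - f').integrable P)).trans_eq ?_
    rw [hD]
    simp only [coe_sub, Pi.sub_apply]
    ring
  have hmass (c : ℝ) (hc : 0 ≤ c) : ∫ _, c ∂P ≤ c := by
    rw [integral_const, smul_eq_mul]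
    exact mul_le_of_le_one_left hc measureReal_le_one
  calc ∫ q, ‖(flowField hK P Y v f - flowField hK P Y' v' f') q‖ ∂P
      ≤ ∫ q, (L + d * ‖v'‖ * L) * ‖(f - f') q‖ +
          (L * D + d * (B * ‖v - v'‖ + ‖v'‖ * (L * ‖Y - Y'‖))) ∂P :=
        integral_mono (BoundedContinuousFunction.integrable P _).norm
          ((hint.const_mul _).add (integrable_const _)) hpoint
    _ ≤ (L + d * ‖v'‖ * L) * D + (L * D + d * (B * ‖v - v'‖ + ‖v'‖ * (L * ‖Y - Y'‖))) := by
        rw [integral_add (hint.const_mul _) (integrable_const _), integral_const_mul]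
        gcongr
        exact hmass _ (by positivity)
    _ = _ := by ring

namespace IsLagrangianSolution

variable {T : ℝ} {u u' : ℝ → Fin m → AgentSpace d} {Y₀ : Fin m → AgentSpace d}
  {Y Y' : ℝ → Fin m → AgentSpace d} {δ : ℝ≥0} {t : ℝ}

theorem compContinuous [OpensMeasurableSpace Ω] {Ω' : Type*} [TopologicalSpace Ω']
    [MeasurableSpace Ω'] [OpensMeasurableSpace Ω'] {P : Measure Ω'}
    [IsZeroOrProbabilityMeasure P] {p : C(Ω', Ω)} {x₀ : Ω →ᵇ AgentSpace d}
    {Φ : ℝ → Ω →ᵇ AgentSpace d} (h : IsLagrangianSolution hK (P.map p) T u Y₀ x₀ Y Φ)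
    (hp : Measurable p) :
    IsLagrangianSolution hK P T u Y₀ (x₀.compContinuous p) Y fun t => (Φ t).compContinuous p where
  initial_leaders := h.initial_leaders
  initial_flow := by rw [h.initial_flow]
  leaders := h.leaders
  flow := by
    have hfield (t : ℝ) : (flowField hK (P.map p) (Y t) (u t) (Φ t)).compContinuous p =
        flowField hK P (Y t) (u t) ((Φ t).compContinuous p) := by
      ext1 q
      change velocity H G ((P.map p).map (Φ t)) _ _ _ = velocity H G (P.map (Φ t ∘ p)) _ _ _
      rw [Measure.map_map (Φ t).continuous.measurable hp]
      rfl
    simpa only [← hfield] using! h.flow.clm_comp (compContinuousCLM (AgentSpace d) ℝ p)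

variable {P : Measure Ω} [IsZeroOrProbabilityMeasure P] {x₀ x₀' : Ω →ᵇ AgentSpace d}
  {Φ Φ' : ℝ → Ω →ᵇ AgentSpace d}

theorem norm_leaders_sub_le [OpensMeasurableSpace Ω] {Ω' : Type*} [TopologicalSpace Ω']
    [MeasurableSpace Ω'] [OpensMeasurableSpace Ω'] {P' : Measure Ω'} [IsZeroOrProbabilityMeasure P']
    {x₀' : Ω' →ᵇ AgentSpace d} {Φ' : ℝ → Ω' →ᵇ AgentSpace d}
    (h : IsLagrangianSolution hK P T u Y₀ x₀ Y Φ)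
    (h' : IsLagrangianSolution hK P' T u' Y₀ x₀' Y' Φ')
    (huu' : ∀ᵐ t ∂(volume.restrict (Icc 0 T)), ‖u t - u' t‖ ≤ δ) (ht : t ∈ Icc 0 T) :
    ‖Y t - Y' t‖ ≤ δ * T := by
  have hle := (h.leaders.sub h'.leaders).norm_le (K := 0) le_rfl δ.coe_nonneg
    (by simpa only [zero_mul, zero_add] using huu') ht
  simpa [h.initial_leaders, h'.initial_leaders] using hle

theorem integral_norm_flow_sub_le [BorelSpace Ω]
    (h : IsLagrangianSolution hK P T u Y₀ x₀ Y Φ)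
    (h' : IsLagrangianSolution hK P T u' Y₀ x₀' Y' Φ')
    (hu' : IsControl T (Metric.closedBall 0 U) u')
    (huu' : ∀ᵐ t ∂(volume.restrict (Icc 0 T)), ‖u t - u' t‖ ≤ δ) (ht : t ∈ Icc 0 T) :
    ∫ q, ‖(Φ t - Φ' t) q‖ ∂P ≤ (∫ q, ‖(x₀ - x₀') q‖ ∂P + d * (B + U * L * T) * δ * T) *
      Real.exp ((2 + d * U) * L * T) := by
  have hT := ht.1.trans ht.2
  have hflow := (h.flow.sub h'.flow).clm_comp (BoundedContinuousFunction.toLp 1 P ℝ)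
  have hle := hflow.norm_le (K := (2 + d * U) * L) (ε := d * (B + U * L * T) * δ) (by positivity)
    (by positivity) ?_ ht
  · simpa only [norm_toLp_one_bcf, h.initial_flow, h'.initial_flow] using hle
  filter_upwards [hu'.ae_norm_le, huu', ae_restrict_mem measurableSet_Icc] with s hUs hδs hs
  simp only [norm_toLp_one_bcf]
  set D := ∫ q, ‖(Φ s - Φ' s) q‖ ∂P
  have : 0 ≤ D := integral_nonneg fun _ => norm_nonneg _
  calc ∫ q, ‖(flowField hK P (Y s) (u s) (Φ s) - flowField hK P (Y' s) (u' s) (Φ' s)) q‖ ∂P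
      ≤ L * (D + D) + d * (B * ‖u s - u' s‖ + ‖u' s‖ * (L * (D + ‖Y s - Y' s‖))) :=
        integral_norm_flowField_sub_le P _ _ _ _ _ _
    _ ≤ L * (D + D) + d * (B * δ + U * (L * (D + δ * T))) := by
        gcongr
        exact h.norm_leaders_sub_le h' huu' hs
    _ = _ := by ring

end IsLagrangianSolution

end Stability

section Convergence

variable {d m : ℕ} {H : AgentSpace d → AgentSpace d} {G : Fin d → AgentSpace d → AgentSpace d}
  {L B U : ℝ≥0} {hK : BoundedLipschitzKernels L B H G} {T : ℝ} {Y₀ : Fin m → AgentSpace d}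
  {x₀ : AgentSpace d →ᵇ AgentSpace d} {K₀ : ℝ≥0}

theorem lintegral_edist_bcf {Ω : Type*} [TopologicalSpace Ω] [MeasurableSpace Ω]
    [OpensMeasurableSpace Ω] (P : Measure Ω) [IsFiniteMeasure P] (f g : Ω →ᵇ AgentSpace d) :
    ∫⁻ q, edist (f q) (g q) ∂P = ENNReal.ofReal (∫ q, ‖(f - g) q‖ ∂P) := by
  rw [ofReal_integral_norm_eq_lintegral_enorm ((f - g).integrable P)]
  simp only [edist_eq_enorm_sub, coe_sub, Pi.sub_apply]

namespace IsLagrangianSolution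

variable {u u' : ℝ → Fin m → AgentSpace d} {Y Y' : ℝ → Fin m → AgentSpace d}
  {Φ Φ' : ℝ → AgentSpace d →ᵇ AgentSpace d} {ν ν' : Measure (AgentSpace d)} {δ : ℝ≥0} {t : ℝ}

theorem lintegral_edist_flow_le {Ω : Type*} [TopologicalSpace Ω] [MeasurableSpace Ω]
    [BorelSpace Ω] {P : Measure Ω} [IsZeroOrProbabilityMeasure P] {x₀ x₀' : Ω →ᵇ AgentSpace d}
    {Φ Φ' : ℝ → Ω →ᵇ AgentSpace d} (h : IsLagrangianSolution hK P T u Y₀ x₀ Y Φ)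
    (h' : IsLagrangianSolution hK P T u' Y₀ x₀' Y' Φ')
    (hu' : IsControl T (Metric.closedBall 0 U) u')
    (huu' : ∀ᵐ t ∂(volume.restrict (Icc 0 T)), ‖u t - u' t‖ ≤ δ) (ht : t ∈ Icc 0 T) :
    ∫⁻ q, edist (Φ t q) (Φ' t q) ∂P ≤
      (∫⁻ q, edist (x₀ q) (x₀' q) ∂P + ENNReal.ofReal (d * (B + U * L * T) * T) * δ) *
        ENNReal.ofReal (Real.exp ((2 + d * U) * L * T)) := by
  have hT := ht.1.trans ht.2
  rw [lintegral_edist_bcf, lintegral_edist_bcf, ← ENNReal.ofReal_coe_nnreal,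
    ← ENNReal.ofReal_mul (by positivity), ← ENNReal.ofReal_add (by positivity) (by positivity),
    ← ENNReal.ofReal_mul (by positivity), mul_right_comm]
  exact ENNReal.ofReal_le_ofReal (h.integral_norm_flow_sub_le h' hu' huu' ht)

theorem wassersteinOne_map_flow_le [IsZeroOrProbabilityMeasure ν] [IsProbabilityMeasure ν']
    (hK₀ : K₀ ≠ 0) (hx₀ : LipschitzWith K₀ x₀)
    (h : IsLagrangianSolution hK ν T u Y₀ x₀ Y Φ) (h' : IsLagrangianSolution hK ν' T u' Y₀ x₀ Y' Φ')
    (hu' : IsControl T (Metric.closedBall 0 U) u')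
    (huu' : ∀ᵐ t ∂(volume.restrict (Icc 0 T)), ‖u t - u' t‖ ≤ δ) (ht : t ∈ Icc 0 T) :
    wassersteinOne (ν.map (Φ t)) (ν'.map (Φ' t)) ≤
      (ENNReal.ofReal (d * (B + U * L * T) * T) * δ + K₀ * wassersteinOne ν ν') *
        ENNReal.ofReal (Real.exp ((2 + d * U) * L * T)) := by
  set E := ENNReal.ofReal (Real.exp ((2 + d * U) * L * T))
  have hE : E ≠ 0 := ENNReal.ofReal_ne_zero_iff.2 (Real.exp_pos _)
  have hE' : E ≠ ⊤ := ENNReal.ofReal_ne_top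
  rw [add_mul, mul_right_comm (K₀ : ℝ≥0∞)]
  refine le_add_mul_wassersteinOne (mul_ne_zero (by exact_mod_cast hK₀) hE)
    (ENNReal.mul_ne_top ENNReal.coe_ne_top hE') ?_
  rintro π rfl rfl
  have : IsProbabilityMeasure π := Measure.isProbabilityMeasure_of_map Prod.snd
  have hflow := (h.compContinuous (p := ⟨Prod.fst, continuous_fst⟩)
    measurable_fst).lintegral_edist_flow_le
      (h'.compContinuous (p := ⟨Prod.snd, continuous_snd⟩) measurable_snd) hu' huu' ht
  have hx : ∫⁻ p, edist (x₀ p.1) (x₀ p.2) ∂π ≤ K₀ * ∫⁻ p, edist p.1 p.2 ∂π := by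
    rw [← lintegral_const_mul _ (by fun_prop)]
    exact lintegral_mono fun p => hx₀ p.1 p.2
  rw [Measure.map_map (Φ t).continuous.measurable measurable_fst,
    Measure.map_map (Φ' t).continuous.measurable measurable_snd]
  refine (wassersteinOne_map_le ((Φ t).continuous.measurable.comp measurable_fst)
    ((Φ' t).continuous.measurable.comp measurable_snd)).trans (hflow.trans ?_)
  calc (∫⁻ p, edist (x₀ p.1) (x₀ p.2) ∂π + ENNReal.ofReal (d * (B + U * L * T) * T) * δ) * E
      ≤ (K₀ * ∫⁻ p, edist p.1 p.2 ∂π + ENNReal.ofReal (d * (B + U * L * T) * T) * δ) * E := by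
        gcongr
    _ = ENNReal.ofReal (d * (B + U * L * T) * T) * δ * E +
          K₀ * E * ∫⁻ p, edist p.1 p.2 ∂π := by ring

theorem chiDist_le [IsZeroOrProbabilityMeasure ν] [IsProbabilityMeasure ν']
    (hK₀ : K₀ ≠ 0) (hx₀ : LipschitzWith K₀ x₀)
    (h : IsLagrangianSolution hK ν T u Y₀ x₀ Y Φ) (h' : IsLagrangianSolution hK ν' T u' Y₀ x₀ Y' Φ')
    (hu' : IsControl T (Metric.closedBall 0 U) u')
    (huu' : ∀ᵐ t ∂(volume.restrict (Icc 0 T)), ‖u t - u' t‖ ≤ δ) (ht : t ∈ Icc 0 T) :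
    chiDist (Y t) (ν.map (Φ t)) (Y' t) (ν'.map (Φ' t)) ≤ δ * ENNReal.ofReal T +
      (ENNReal.ofReal (d * (B + U * L * T) * T) * δ + K₀ * wassersteinOne ν ν') *
        ENNReal.ofReal (Real.exp ((2 + d * U) * L * T)) := by
  refine (_root_.chiDist_le _ _ _ _).trans (add_le_add ?_
    (h.wassersteinOne_map_flow_le hK₀ hx₀ h' hu' huu' ht))
  rw [edist_dist, dist_eq_norm, ← ENNReal.ofReal_coe_nnreal, ← ENNReal.ofReal_mul δ.coe_nonneg]
  exact ENNReal.ofReal_le_ofReal (h.norm_leaders_sub_le h' huu' ht)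

end IsLagrangianSolution

theorem ae_norm_le_toNNReal_eLpNorm {α E : Type*} [MeasurableSpace α] [NormedAddCommGroup E]
    {κ : Measure α} {f : α → E} (hf : eLpNorm f ⊤ κ ≠ ⊤) :
    ∀ᵐ s ∂κ, ‖f s‖ ≤ (eLpNorm f ⊤ κ).toNNReal := by
  rw [eLpNorm_exponent_top] at hf ⊢
  filter_upwards [enorm_ae_le_eLpNormEssSup f κ] with s hs
  rw [← toReal_enorm]
  exact ENNReal.toReal_mono hf hs

theorem tendsto_iSup_chiDist {ι : Type*} {l : Filter ι} {ν : ι → Measure (AgentSpace d)}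
    [∀ n, IsZeroOrProbabilityMeasure (ν n)] {ν' : Measure (AgentSpace d)} [IsProbabilityMeasure ν']
    {u : ι → ℝ → Fin m → AgentSpace d} {u' : ℝ → Fin m → AgentSpace d}
    {Y : ι → ℝ → Fin m → AgentSpace d} {Y' : ℝ → Fin m → AgentSpace d}
    {Φ : ι → ℝ → AgentSpace d →ᵇ AgentSpace d} {Φ' : ℝ → AgentSpace d →ᵇ AgentSpace d}
    (hK₀ : K₀ ≠ 0) (hx₀ : LipschitzWith K₀ x₀)
    (h : ∀ n, IsLagrangianSolution hK (ν n) T (u n) Y₀ x₀ (Y n) (Φ n))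
    (h' : IsLagrangianSolution hK ν' T u' Y₀ x₀ Y' Φ')
    (hu' : IsControl T (Metric.closedBall 0 U) u')
    (hν : Tendsto (fun n => wassersteinOne (ν n) ν') l (𝓝 0))
    (hu : Tendsto (fun n => eLpNorm (fun t => u n t - u' t) ⊤ (volume.restrict (Icc 0 T))) l
      (𝓝 0)) :
    Tendsto (fun n => ⨆ t ∈ Icc 0 T, chiDist (Y n t) ((ν n).map (Φ n t)) (Y' t) (ν'.map (Φ' t))) l
      (𝓝 0) := by
  set e := fun n => eLpNorm (fun t => u n t - u' t) ⊤ (volume.restrict (Icc 0 T))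
  set c := ENNReal.ofReal (d * (B + U * L * T) * T)
  set E := ENNReal.ofReal (Real.exp ((2 + d * U) * L * T))
  have hlim : Tendsto
      (fun n => e n * ENNReal.ofReal T + (c * e n + K₀ * wassersteinOne (ν n) ν') * E) l (𝓝 0) := by
    have hcu : Tendsto (fun n => c * e n) l (𝓝 (c * 0)) :=
      ENNReal.Tendsto.const_mul hu (.inr ENNReal.ofReal_ne_top)
    have hKν : Tendsto (fun n => K₀ * wassersteinOne (ν n) ν') l (𝓝 (K₀ * 0)) :=
      ENNReal.Tendsto.const_mul hν (.inr ENNReal.coe_ne_top)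
    have huT : Tendsto (fun n => e n * ENNReal.ofReal T) l (𝓝 (0 * ENNReal.ofReal T)) :=
      ENNReal.Tendsto.mul_const hu (.inr ENNReal.ofReal_ne_top)
    simpa only [zero_mul, mul_zero, add_zero] using
      huT.add (ENNReal.Tendsto.mul_const (hcu.add hKν) (.inr (ENNReal.ofReal_ne_top : E ≠ ⊤)))
  refine tendsto_of_tendsto_of_tendsto_of_le_of_le' tendsto_const_nhds hlim
    (.of_forall fun _ => zero_le) ?_
  filter_upwards [hu.eventually_lt_const ENNReal.zero_lt_top] with n hn
  refine iSup₂_le fun t ht => ?_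
  have hdist := (h n).chiDist_le hK₀ hx₀ h' hu' (ae_norm_le_toNNReal_eLpNorm hn.ne) ht
  rwa [ENNReal.coe_toNNReal hn.ne] at hdist

end Convergence

section Uniqueness

variable {d m N : ℕ} {H : AgentSpace d → AgentSpace d} {G : Fin d → AgentSpace d → AgentSpace d}
  {U : ℝ≥0} {T : ℝ} {u : ℝ → Fin m → AgentSpace d} {Y₀ : Fin m → AgentSpace d}
  {X₀ : Fin N → AgentSpace d} {Y Y' : ℝ → Fin m → AgentSpace d} {X X' : ℝ → Fin N → AgentSpace d}

theorem lipschitzWith_velocity_empirical {L B : ℝ≥0} (hK : BoundedLipschitzKernels L B H G)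
    {v : Fin m → AgentSpace d} (hv : ‖v‖ ≤ U) (Y : Fin m → AgentSpace d) :
    LipschitzWith ((2 + d * U) * L) fun (X : Fin N → AgentSpace d) i =>
      velocity H G (empirical X) Y v (X i) := by
  refine LipschitzWith.of_dist_le_mul fun X X' => (dist_pi_le_iff (by positivity)).2 fun i => ?_
  have hflow := (lipschitzWith_flowField hK (ProbabilityTheory.uniformOn univ) hv Y).dist_le_mul
    (mkOfCompact ⟨X, continuous_of_discreteTopology⟩)
    (mkOfCompact ⟨X', continuous_of_discreteTopology⟩)
  rw [empirical_eq_map_uniformOn, empirical_eq_map_uniformOn]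
  refine (dist_coe_le_dist i).trans (hflow.trans ?_)
  gcongr
  exact (dist_le dist_nonneg).2 fun j => dist_le_pi_dist X X' j

namespace IsFiniteSolution

theorem eqOn_of_boundedLipschitzKernels {L B : ℝ≥0} (hK : BoundedLipschitzKernels L B H G)
    (hu : IsControl T (Metric.closedBall 0 U) u) (h : IsFiniteSolution H G T u Y₀ X₀ Y X)
    (h' : IsFiniteSolution H G T u Y₀ X₀ Y' X') :
    EqOn Y Y' (Icc 0 T) ∧ EqOn X X' (Icc 0 T) := by
  have hY : EqOn Y Y' (Icc 0 T) :=
    (HasCaratheodoryDeriv.pi h.leaders).eqOn le_rfl (.pi h'.leaders)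
      (.of_forall fun t => by simp) (h.initial_leaders.trans h'.initial_leaders.symm)
  refine ⟨hY, (HasCaratheodoryDeriv.pi h.followers).eqOn ((2 + d * U) * L : ℝ≥0).coe_nonneg
    (.pi h'.followers) ?_ (h.initial_followers.trans h'.initial_followers.symm)⟩
  filter_upwards [hu.ae_norm_le, ae_restrict_mem measurableSet_Icc] with t hut ht
  simpa only [hY ht, dist_eq_norm] using
    (lipschitzWith_velocity_empirical hK hut (Y' t)).dist_le_mul (X t) (X' t)

theorem exists_norm_le (h : IsFiniteSolution H G T u Y₀ X₀ Y X) :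
    ∃ ρ, ∀ t ∈ Icc 0 T, ‖Y t‖ ≤ ρ ∧ ‖X t‖ ≤ ρ := by
  obtain ⟨a, ha⟩ := isCompact_Icc.exists_bound_of_continuousOn
    (HasCaratheodoryDeriv.pi h.leaders).continuousOn
  obtain ⟨b, hb⟩ := isCompact_Icc.exists_bound_of_continuousOn
    (HasCaratheodoryDeriv.pi h.followers).continuousOn
  exact ⟨max a b, fun t ht => ⟨(ha t ht).trans (le_max_left a b),
    (hb t ht).trans (le_max_right a b)⟩⟩

theorem eqOn (hHG : KernelHypothesis H G) (hu : IsControl T (Metric.closedBall 0 U) u)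
    (h : IsFiniteSolution H G T u Y₀ X₀ Y X) (h' : IsFiniteSolution H G T u Y₀ X₀ Y' X') :
    EqOn Y Y' (Icc 0 T) ∧ EqOn X X' (Icc 0 T) := by
  obtain ⟨ρ, hρ⟩ := h.exists_norm_le
  obtain ⟨ρ', hρ'⟩ := h'.exists_norm_le
  set r := max 1 (max ρ ρ')
  have hr : 0 < 2 * r := mul_pos two_pos (one_pos.trans_le (le_max_left _ _))
  have hρr : ρ ≤ r := (le_max_left _ _).trans (le_max_right _ _)
  have hρr' : ρ' ≤ r := (le_max_right _ _).trans (le_max_right _ _)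
  obtain ⟨L, B, hK⟩ := hHG.exists_boundedLipschitzKernels hr
  have hHGr := kernelsEqOn_comp_ballRetraction (H := H) (G := G) hr
  refine eqOn_of_boundedLipschitzKernels hK hu
    (h.congr_kernels hHGr (fun t ht => (hρ t ht).1.trans hρr) fun t ht i => ?_)
    (h'.congr_kernels hHGr (fun t ht => (hρ' t ht).1.trans hρr') fun t ht i => ?_)
  · exact (norm_le_pi_norm _ i).trans ((hρ t ht).2.trans hρr)
  · exact (norm_le_pi_norm _ i).trans ((hρ' t ht).2.trans hρr')

end IsFiniteSolution

end Uniqueness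

section Truncation

variable {d m : ℕ} {H H' : AgentSpace d → AgentSpace d} {G G' : Fin d → AgentSpace d → AgentSpace d}
  {L B C U : ℝ≥0} {T r : ℝ} {u : ℝ → Fin m → AgentSpace d} {Y₀ : Fin m → AgentSpace d}
  {Y : ℝ → Fin m → AgentSpace d} {x₀ : AgentSpace d →ᵇ AgentSpace d}
  {Φ : ℝ → AgentSpace d →ᵇ AgentSpace d} {hK : BoundedLipschitzKernels L B H G}

namespace IsLagrangianSolution

theorem isFiniteSolution_of_kernelsEqOn {N : ℕ} {X₀ : Fin N → AgentSpace d}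
    (h : IsLagrangianSolution hK (empirical X₀) T u Y₀ x₀ Y Φ) (hC : LinearGrowthKernels C H G)
    (hHG : KernelsEqOn (2 * aprioriBound d C U T r) H H' G G')
    (hu : IsControl T (Metric.closedBall 0 U) u) (hY₀ : ‖Y₀‖ ≤ r) (hx₀ : ‖x₀‖ ≤ r)
    (hx₀X₀ : ∀ i, x₀ (X₀ i) = X₀ i) :
    IsFiniteSolution H' G' T u Y₀ X₀ Y fun t i => Φ t (X₀ i) := by
  have hbound (t) (ht : t ∈ Icc 0 T) := h.norm_le_aprioriBound hC hu hY₀ hx₀ ht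
  exact (h.isFiniteSolution hx₀X₀).congr_kernels hHG (fun t ht => (hbound t ht).1)
    fun t ht i => ((Φ t).norm_coe_le_norm _).trans (hbound t ht).2

theorem isMeanFieldSolution_of_kernelsEqOn {P : Measure (AgentSpace d)} [IsProbabilityMeasure P]
    (h : IsLagrangianSolution hK P T u Y₀ x₀ Y Φ) (hC : LinearGrowthKernels C H G)
    (hHG : KernelsEqOn (2 * aprioriBound d C U T r) H H' G G')
    (hu : IsControl T (Metric.closedBall 0 U) u) (hY₀ : ‖Y₀‖ ≤ r) (hx₀ : ‖x₀‖ ≤ r) :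
    IsMeanFieldSolution H' G' T u Y fun t => P.map (Φ t) := by
  have hbound (t) (ht : t ∈ Icc 0 T) := h.norm_le_aprioriBound hC hu hY₀ hx₀ ht
  exact h.isMeanFieldSolution.congr_kernels hHG (fun t ht => (hbound t ht).1)
    fun t ht => (ae_map_norm_le P (Φ t)).mono fun x hx => hx.trans (hbound t ht).2

end IsLagrangianSolution

end Truncation

end

/-- Mean-field limit: the finite systems are well posed, and their solutions converge in
`C⁰([0,T], χ)` to a weak solution of the coupled ODE / continuity equation. -/
theorem mainTheorem1 {d m : ℕ} (H : AgentSpace d → AgentSpace d)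
    (G : Fin d → AgentSpace d → AgentSpace d) (hHG : KernelHypothesis H G)
    (T : ℝ) (hT : 0 < T)
    (𝒰 : Set (Fin m → AgentSpace d)) (h𝒰 : IsCompact 𝒰) (h𝒰ne : 𝒰.Nonempty)
    (R : ℝ) (Y0 : Fin m → AgentSpace d)
    (μ0 : Measure (AgentSpace d)) (hμ0 : MemP1 μ0) (hμ0R : μ0.support ⊆ Metric.closedBall 0 R)
    (X0 : (N : ℕ) → Fin N → AgentSpace d) (hX0 : ∀ N i, X0 N i ∈ Metric.closedBall 0 R)
    (hX0μ : Tendsto (fun N => wassersteinOne (empirical (X0 N)) μ0) atTop (𝓝 0))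
    (u : ℕ → ℝ → Fin m → AgentSpace d) (hu : ∀ N, IsControl T 𝒰 (u N))
    (uStar : ℝ → Fin m → AgentSpace d) (huStar : IsControl T 𝒰 uStar)
    (huu : Tendsto (fun N => eLpNorm (fun t => u N t - uStar t) ∞
      (volume.restrict (Set.Icc 0 T))) atTop (𝓝 0)) :
    (∀ N, ∃ Y X, IsFiniteSolution H G T (u N) Y0 (X0 N) Y X) ∧
    (∀ N Y X Y' X', IsFiniteSolution H G T (u N) Y0 (X0 N) Y X →
      IsFiniteSolution H G T (u N) Y0 (X0 N) Y' X' →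
      Set.EqOn Y Y' (Set.Icc 0 T) ∧ Set.EqOn X X' (Set.Icc 0 T)) ∧
    ∀ (Y : ℕ → ℝ → Fin m → AgentSpace d) (X : (N : ℕ) → ℝ → Fin N → AgentSpace d),
      (∀ N, IsFiniteSolution H G T (u N) Y0 (X0 N) (Y N) (X N)) →
      ∃ (YStar : ℝ → Fin m → AgentSpace d) (μStar : ℝ → Measure (AgentSpace d)),
        IsMeanFieldSolution H G T uStar YStar μStar ∧ YStar 0 = Y0 ∧ μStar 0 = μ0 ∧
        Tendsto (fun N => ⨆ t ∈ Set.Icc 0 T,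
          chiDist (Y N t) (empirical (X N t)) (YStar t) (μStar t)) atTop (𝓝 0) := by
  have hprob := hμ0.isProbability
  obtain ⟨U, hU₀, hU⟩ := h𝒰.isBounded.subset_closedBall_lt 0 0
  lift U to NNReal using hU₀.le
  replace hu N := (hu N).mono hU
  replace huStar := huStar.mono hU
  set r := ‖Y0‖ + |R| + 1
  have hr : 0 < r := by positivity
  have hY0r : ‖Y0‖ ≤ r := by linarith [abs_nonneg R]
  have hRr : Metric.closedBall (0 : AgentSpace d) R ⊆ Metric.closedBall 0 r :=
    Metric.closedBall_subset_closedBall (by linarith [le_abs_self R, norm_nonneg Y0])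
  obtain ⟨x₀, hx₀L, hx₀r, hx₀⟩ := exists_lipschitzWith_bcf_eqOn_closedBall (E := AgentSpace d) hr
  obtain ⟨C, hC⟩ := hHG.exists_linearGrowthKernels
  have hρ := mul_pos two_pos (aprioriBound_pos (d := d) (C := C) (U := U) hr hT.le)
  obtain ⟨L, B, hK⟩ := hHG.exists_boundedLipschitzKernels hρ
  have hHG' := (kernelsEqOn_comp_ballRetraction (H := H) (G := G) hρ).symm
  choose Y' Φ hΦ using fun N => exists_isLagrangianSolution hK (empirical (X0 N)) hT.le (hu N) Y0 x₀
  obtain ⟨YStar, Ψ, hΨ⟩ := exists_isLagrangianSolution hK μ0 hT.le huStar Y0 x₀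
  have hsol N := (hΦ N).isFiniteSolution_of_kernelsEqOn (hC.comp_ballRetraction hρ) hHG' (hu N)
    hY0r hx₀r fun i => hx₀ (hRr (hX0 N i))
  refine ⟨fun N => ⟨_, _, hsol N⟩, fun N _ _ _ _ h h' => h.eqOn hHG (hu N) h', fun Y X hYX =>
    ⟨YStar, fun t => μ0.map (Ψ t), hΨ.isMeanFieldSolution_of_kernelsEqOn
      (hC.comp_ballRetraction hρ) hHG' huStar hY0r hx₀r, hΨ.initial_leaders, ?_, ?_⟩⟩
  · simp only [hΨ.initial_flow, map_eq_self_of_eqOn_support (hx₀.mono (hμ0R.trans hRr))]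
  · refine (tendsto_iSup_chiDist two_ne_zero hx₀L hΦ hΨ huStar hX0μ huu).congr fun N =>
      biSup_congr fun t ht => ?_
    obtain ⟨hY, hX⟩ := (hYX N).eqOn hHG (hu N) (hsol N)
    rw [hY ht, hX ht, map_empirical (Φ N t).continuous.measurable]
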